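/- **Setting.** Let $\mathbb F$ be a finite field, $\theta$ an automorphism of $\mathbb F$, and $\mathcal R=\mathbb F[x;\theta]$ the skew polynomial ring with $xa=\theta(a)x$ for $a\in\mathbb F$. Write $a\equiv b \bmod c$ if $a=b+dc$ for some $d\in\mathcal R$. For a non-zero $v\in\mathcal R^{n}$ put $\deg v=\max_i\deg v_i$, and let $\mathrm{LP}(v)$ be the largest $i$ with $\deg v_i=\deg v$. A matrix is in weak Popov form if the leading positions $\mathrm{LP}$ of its non-zero rows are pairwise different. For $w\in\mathbb Z_{\ge0}^{\ell+1}$ let $\Phi_w(u_0,\dots,u_\ell)=(u_0x^{w_0},\dots,u_\ell x^{w_\ell})$, applied to matrices row by row; $V$ is in $w$-shifted weak Popov form if $\Phi_w(V)$ is in weak Popov form. **Problem (MgLSSR).** Let $\ell\ge1$, $s_i,g_i\in\mathcal R$ for $1\le i\le\ell$ with $g_i\ne0$ and $\deg s_i\le\deg g_i$, and $\gamma=(\gamma_0,\dots,\gamma_\ell)\in\mathbb Z_{\ge0}^{\ell+1}$. Find $\lambda,\omega_1,\dots,\omega_\ell\in\mathcal R$, with $\lambda$ of minimal degree, such that for all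 $i$ $$\lambda s_i\equiv\omega_i \bmod g_i,\qquad \deg\lambda+\gamma_0>\deg\omega_i+\gamma_i .$$ Let $\mu=\max_{1\le i\le\ell}(\gamma_i+\deg g_i)$, and let $M\in\mathcal R^{(\ell+1)\times(\ell+1)}$ have the rows $(1,s_1,\dots,s_\ell)$ and $(0,\dots,0,g_i,0,\dots,0)$ with $g_i$ in position $i$, for $1\le i\le\ell$ (positions are numbered from $0$). **Algorithm 1.** Set up $M$; compute a $\gamma$-shifted weak Popov form $V$ of $M$, that is, a matrix in $\gamma$-shifted weak Popov form with the same left row space as $M$; return the row $v$ of $V$ with $\mathrm{LP}(\Phi_\gamma(v))=0$. The computation of $V$ is realised in one of two ways. *(MS) Mulders–Storjohann.* Start from $\Phi_\gamma(M)$ and, until this is no longer possible, choose two rows $v_i,v_j$, $i\neq j$, with the same leading position $h$ and with $\deg v_{i,h}\le\deg v_{j,h}$, and replace $v_j$ by $v_j-\alpha x^\beta v_i$, where $\beta=\deg v_{j,h}-\deg v_{i,h}$ and $\alpha=\mathrm{LC}(v_{j,h})/\theta^\beta(\mathrm{LC}(v_{i,h}))$, with $\mathrm{LC}$ denoting the leading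 coefficient. Apply $\Phi_\gamma^{-1}$ to the result. *(DD) Demand-driven* (used when all $g_i=x^{t_i}+c_i$). Only the zeroth column of $V$ is computed. Put $\tilde s_i=s_ix^{\gamma_i}$. Let $(\eta,h)$ be degree and leading position of $(x^{\gamma_0},\tilde s_1,\dots,\tilde s_\ell)$. If $h=0$, the column is $(1,0,\dots,0)$. Otherwise start with $(\lambda_0,\dots,\lambda_\ell)=(x^{\gamma_0},0,\dots,0)$ and with $\alpha_jx^{\eta_j}$ the leading monomial of $g_jx^{\gamma_j}$, $1\le j\le\ell$. While $\deg\lambda_0\le\eta$: let $\alpha$ be the coefficient of $x^\eta$ in $(\lambda_0x^{-\gamma_0}s_h \bmod g_h)\,x^{\gamma_h}$; if $\alpha\ne0$, then first, in case $\eta<\eta_h$, swap $(\lambda_0,\alpha,\eta)$ with $(\lambda_h,\alpha_h,\eta_h)$, and then replace $\lambda_0$ by $\lambda_0-\frac{\alpha}{\theta^{\eta-\eta_h}(\alpha_h)}x^{\eta-\eta_h}\lambda_h$; finally replace $(\eta,h)$ by $(\eta,h-1)$ if $h>1$ and by $(\eta-1,\ell)$ if $h=1$. The column is $(\lambda_0x^{-\gamma_0},\dots,\lambda_\ell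 x^{-\gamma_0})$. With $\lambda$ its entry number $0$, the returned row is $(\lambda,\lambda s_1\bmod g_1,\dots,\lambda s_\ell\bmod g_\ell)$. Coefficients of $as_i\bmod(x^{t_i}+c_i)$ are computed from those coefficients of $as_i$ whose exponents are congruent modulo $t_i$, each of these by convolution. *Cost.* The complexity is the total number of operations $+,-,\cdot,/$ and $\theta^i$ ($i\ge 0$) in $\mathbb F$. A replacement $p-\alpha x^\beta q$ is computed coefficient by coefficient. **Theorem.** There is an absolute constant $K$ such that for every $\mathbb F$, $\theta$ and every instance of the problem as above: 1. Realisation (MS) terminates for every choice of the transformations. It computes a $\gamma$-shifted weak Popov form $V$ of $M$, and the returned row is a solution of the problem. If $\mu\ge1$, it uses at most $K\ell^2\mu^2$ operations. 2. If every $g_i$ is of the form $x^{t_i}+c_i$ with $t_i\in\mathbb Z_{>0}$ and $c_i\in\mathbb F$, then realisation (DD) terminates, the computed column is the zeroth column of a $\gamma$-shifted weak Popov form $V$ of $M$, the returned row is the row of $V$ with $\mathrm{LP}(\Phi_\gamma(v))=0$ and is a solution of the problem, and at most $K\ell\mu^2$ operations are used. So Algorithm 1 has complexity $O(\ell\mu^2)$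 if all $g_i=x^{t_i}+c_i$ with $t_i>0$, and $O(\ell^2\mu^2)$ otherwise. -/

import Mathlib

noncomputable section

namespace SkewShiftRegister

open SkewPolynomial

universe u

/-! ### Computations that count field operations -/

/-- A value together with the number of field operations spent on computing it. -/
structure Cost (α : Type u) where
  val : α
  ops : ℕ

namespace Cost

instance : Monad Cost where
  pure a := ⟨a, 0⟩
  bind c f := ⟨(f c.val).val, c.ops + (f c.val).ops⟩

/-- Run independent computations, one for each index, and collect the results. -/
def pi {n : ℕ} {α : Type u} (f : Fin n → Cost α) : Cost (Fin n → α) :=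
  ⟨fun k => (f k).val, ∑ k, (f k).ops⟩

/-- `for k = 0, …, n - 1 do s ← body k s`. -/
def forRange {σ : Type u} (body : ℕ → σ → Cost σ) : ℕ → σ → Cost σ
  | 0, s => pure s
  | n + 1, s => forRange body n s >>= body n

end Cost

/-- `Loop step s c`: repeating `step`, possible steps being chosen freely, until no step is possible
can lead from the state `s` to the state `c.val`, with `c.ops` operations in total. -/
inductive Loop {σ : Type u} (step : σ → Cost σ → Prop) : σ → Cost σ → Prop
  | halt (s : σ) : (∀ c, ¬ step s c) → Loop step s ⟨s, 0⟩
  | next (s : σ) (c d : Cost σ) : step s c → Loop step c.val d → Loop step s ⟨d.val, c.ops + d.ops⟩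

/-- There is no infinite sequence of steps starting in `s`. -/
def Terminates {σ : Type u} (step : σ → Cost σ → Prop) (s : σ) : Prop :=
  Acc (fun t' t => ∃ c, step t c ∧ c.val = t') s

/-! ### Skew polynomials -/

/-- The action of `ℕ` on `F` by the powers of the automorphism `θ`. It makes `SkewPolynomial F`
the ring `F[x; θ]`, in which `x a = θ(a) x`. -/
@[reducible] def autAction {F : Type u} [Field F] (θ : F ≃+* F) :
    MulSemiringAction (Multiplicative ℕ) F :=
  letI : MulSemiringAction (RingAut F) F := inferInstance
  MulSemiringAction.compHom F (powersHom (RingAut F) θ)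

theorem autAction_phi {F : Type u} [Field F] (θ : F ≃+* F) (a : F) :
    (letI := autAction θ; (φ a : F)) = θ a := by
  simp [MulSemiringAction.toRingHom_apply]
  rfl

variable {F : Type u} [Field F]

/-- The degree, with `deg 0 = ⊥`. -/
def deg (p : SkewPolynomial F) : WithBot ℕ := p.support.max

/-- The degree as a natural number, with the value `0` at `0`. -/
def natDeg (p : SkewPolynomial F) : ℕ := p.support.sup id

/-- The leading coefficient. -/
def leadCoeff (p : SkewPolynomial F) : F := p.coeff (natDeg p)

/-- `p x^{-w}`, for `p` divisible by `x^w` on the right. -/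
def shiftDown (w : ℕ) (p : SkewPolynomial F) : SkewPolynomial F :=
  p.sum fun n a => monomial (n - w) a

/-- The leading position of a vector: the rightmost position of maximal degree; `⊥` for the
zero vector. -/
def leadPos {n : ℕ} (v : Fin n → SkewPolynomial F) : WithBot (Fin n) :=
  open Classical in
  (Finset.univ.filter fun i => v i ≠ 0 ∧ ∀ j, deg (v j) ≤ deg (v i)).max

/-- Weak Popov form: the leading positions of the non-zero rows are pairwise different. -/
def WeakPopov {m n : ℕ} (V : Fin m → Fin n → SkewPolynomial F) : Prop :=
  ∀ i j, i ≠ j → V i ≠ 0 → V j ≠ 0 → leadPos (V i) ≠ leadPos (V j)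

variable [MulSemiringAction (Multiplicative ℕ) F]

/-- The map `Φ_w : (u_0, …, u_ℓ) ↦ (u_0 x^{w_0}, …, u_ℓ x^{w_ℓ})`. -/
def shift {n : ℕ} (w : Fin n → ℕ) (v : Fin n → SkewPolynomial F) : Fin n → SkewPolynomial F :=
  fun i => v i * X ^ w i

/-- `w`-shifted weak Popov form. -/
def ShiftedWeakPopov {m n : ℕ} (w : Fin n → ℕ) (V : Fin m → Fin n → SkewPolynomial F) : Prop :=
  WeakPopov fun i => shift w (V i)

/-- The right modulo relation `a ≡ b mod c`. -/
def ModEq (c a b : SkewPolynomial F) : Prop := ∃ d, a = b + d * c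

/-! ### Counted operations. The `φ^[i] a` below is `θ^i(a)`. -/

def add (a b : F) : Cost F := ⟨a + b, 1⟩
def sub (a b : F) : Cost F := ⟨a - b, 1⟩
def mul (a b : F) : Cost F := ⟨a * b, 1⟩
def div (a b : F) : Cost F := ⟨a / b, 1⟩
def frob (i : ℕ) (a : F) : Cost F := ⟨φ^[i] a, 1⟩

/-- Computes `p - α x^β q`, coefficient by coefficient. -/
def subMulShift (α : F) (β : ℕ) (p q : SkewPolynomial F) : Cost (SkewPolynomial F) :=
  Cost.forRange (fun k r => do
    let t ← frob β (q.coeff k)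
    let t ← mul α t
    let t ← sub (r.coeff (k + β)) t
    pure (r.update (k + β) t)) (natDeg q + 1) p

/-- Computes the coefficient of `x^m` in `a s` by convolution. -/
def mulCoeff (a s : SkewPolynomial F) (m : ℕ) : Cost F :=
  Cost.forRange (fun j acc => do
    let t ← frob (m - j) (s.coeff j)
    let t ← mul (a.coeff (m - j)) t
    add acc t) (min m (natDeg s) + 1) 0

/-- Computes, for `t > 0`, the coefficient of `x^n` in the remainder of `a s` modulo `x^t + c`. It
is the combination of the coefficients of `x^n, x^(n + t), x^(n + 2 t), …` in `a s` with the weights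
`∏_{j < k} (-θ^(n + j t)(c))`, as `b x^(m + t) ≡ -b θ^m(c) x^m mod x^t + c`. The pair holds the
partial sum and the current weight. -/
def modCoeff (t : ℕ) (c : F) (a s : SkewPolynomial F) (n : ℕ) : Cost F :=
  if t ≤ n then pure 0
  else do
    let r ← Cost.forRange (fun k (r : F × F) => do
      let q ← mulCoeff a s (n + k * t)
      let q ← mul q r.2
      let acc ← add r.1 q
      let e ← frob (n + k * t) c
      let e ← mul r.2 e
      let e ← sub 0 e
      pure (acc, e)) ((natDeg a + natDeg s - n) / t + 1) (0, 1)
    pure r.1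

/-! ### The shift-register problem -/

variable (F) in
/-- The data `s_i, g_i` (`i = 1, …, ℓ`) and `γ_i` (`i = 0, …, ℓ`) of the problem. The sequences are
indexed by `i : Fin ℓ`, and sequence `i` belongs to position `i.succ` of a vector. -/
structure Problem (ℓ : ℕ) where
  s : Fin ℓ → SkewPolynomial F
  g : Fin ℓ → SkewPolynomial F
  γ : Fin (ℓ + 1) → ℕ

namespace Problem

variable {ℓ : ℕ} (I : Problem F ℓ)

/-- `μ = max_i (γ_i + deg g_i)`. -/
def μ : ℕ := Finset.univ.sup fun i : Fin ℓ => I.γ i.succ + natDeg (I.g i)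

/-- The congruences and the degree constraints on `(λ, ω_1, …, ω_ℓ)`. -/
def Feasible (v : Fin (ℓ + 1) → SkewPolynomial F) : Prop :=
  ∀ i : Fin ℓ, ModEq (I.g i) (v 0 * I.s i) (v i.succ) ∧
    deg (v i.succ) + (I.γ i.succ : WithBot ℕ) < deg (v 0) + (I.γ 0 : WithBot ℕ)

/-- A solution: feasible, with `λ` of minimal degree. -/
def IsSolution (v : Fin (ℓ + 1) → SkewPolynomial F) : Prop :=
  I.Feasible v ∧ ∀ u, I.Feasible u → deg (v 0) ≤ deg (u 0)

/-- The matrix `M` with the rows `(1, s_1, …, s_ℓ)` and `(0, …, g_i, …, 0)`. -/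
def M : Fin (ℓ + 1) → Fin (ℓ + 1) → SkewPolynomial F :=
  Matrix.vecCons (Matrix.vecCons 1 I.s) fun i => Matrix.vecCons 0 (Pi.single i (I.g i))

/-- `V` is a shifted weak Popov form of `M`: it has the same row space and is in `γ`-shifted weak
Popov form. -/
def IsReduction (V : Fin (ℓ + 1) → Fin (ℓ + 1) → SkewPolynomial F) : Prop :=
  Submodule.span (SkewPolynomial F) (Set.range V) =
    Submodule.span (SkewPolynomial F) (Set.range I.M) ∧ ShiftedWeakPopov I.γ V

end Problem

/-! ### Row reduction by the Mulders–Storjohann algorithm -/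

section MuldersStorjohann

variable {m : ℕ}

/-- The simple transformation `i` on `j` at position `h`: replaces row `j` by
`v_j - α x^β v_i`, where `β = deg v_{j,h} - deg v_{i,h}` and
`α = LC(v_{j,h}) / θ^β(LC(v_{i,h}))`. -/
def simpleTransformation (i j h : Fin m) (V : Fin m → Fin m → SkewPolynomial F) :
    Cost (Fin m → Fin m → SkewPolynomial F) := do
  let β := natDeg (V j h) - natDeg (V i h)
  let t ← frob β (leadCoeff (V i h))
  let α ← div (leadCoeff (V j h)) t
  let row ← Cost.pi fun k => subMulShift α β (V j k) (V i k)
  pure (Function.update V j row)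

/-- Any simple transformation of one row on another with the same leading position, at that
position. -/
def MSStep (V : Fin m → Fin m → SkewPolynomial F)
    (c : Cost (Fin m → Fin m → SkewPolynomial F)) : Prop :=
  ∃ i j h : Fin m, i ≠ j ∧ leadPos (V i) = h ∧ leadPos (V j) = h ∧
    deg (V i h) ≤ deg (V j h) ∧ c = simpleTransformation i j h V

end MuldersStorjohann

namespace Problem

variable {ℓ : ℕ} (I : Problem F ℓ)

/-- `Φ_γ(M)`, the matrix to be reduced. -/
def shiftedM : Fin (ℓ + 1) → Fin (ℓ + 1) → SkewPolynomial F := fun i => shift I.γ (I.M i)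

/-- Solving the problem by row reduction with the Mulders–Storjohann algorithm: reduce `Φ_γ(M)`
to `W` by simple transformations until none is possible, let `V = Φ_γ⁻¹(W)`, and return the row `v`
of `V` with the leading position of `Φ_γ(v)` being `0`. The result holds `V` and `v`. -/
def MSRun (c : Cost ((Fin (ℓ + 1) → Fin (ℓ + 1) → SkewPolynomial F) ×
    (Fin (ℓ + 1) → SkewPolynomial F))) : Prop :=
  ∃ W, Loop MSStep I.shiftedM W ∧
    c.val.1 = (fun i k => shiftDown (I.γ k) (W.val i k)) ∧
    (∃ i, c.val.2 = c.val.1 i ∧ leadPos (shift I.γ (c.val.1 i)) = (0 : Fin (ℓ + 1))) ∧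
    c.ops = W.ops

end Problem

/-! ### Row reduction by the demand-driven algorithm -/

/-- The variables of the demand-driven algorithm: `λ_0, …, λ_ℓ`, then `α_h` and `η_h` for
`h = 1, …, ℓ`, and the current pair `(η, h)`. -/
@[ext] structure DDState (F : Type u) [Field F] (ℓ : ℕ) where
  lam : Fin (ℓ + 1) → SkewPolynomial F
  lead : Fin ℓ → F
  top : Fin ℓ → ℤ
  η : ℤ
  h : Fin ℓ

namespace DDState

variable {ℓ : ℕ}

/-- Swaps `(λ_0, α, η)` with `(λ_h, α_h, η_h)`, where `α` is not stored in the state: the new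
value of `α` is the first component of the result. -/
def swap (α : F) (S : DDState F ℓ) : F × DDState F ℓ :=
  (S.lead S.h,
    { S with
      lam := Function.update (Function.update S.lam 0 (S.lam S.h.succ)) S.h.succ (S.lam 0)
      lead := Function.update S.lead S.h α
      top := Function.update S.top S.h S.η
      η := S.top S.h })

/-- `(η, h) ← (η, h - 1)` if `h > 1`, and `(η - 1, ℓ)` otherwise. -/
def decrement (S : DDState F ℓ) : DDState F ℓ :=
  if S.h.val = 0 then
    { S with η := S.η - 1, h := ⟨ℓ - 1, by have := S.h.isLt; omega⟩ }
  else
    { S with h := ⟨S.h.val - 1, by have := S.h.isLt; omega⟩ }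

/-- `λ_0 ← λ_0 - α / θ^{η - η_h}(α_h) x^{η - η_h} λ_h`. -/
def reduce (α : F) (S : DDState F ℓ) : Cost (DDState F ℓ) := do
  let β := (S.η - S.top S.h).toNat
  let t ← frob β (S.lead S.h)
  let q ← div α t
  let p ← subMulShift q β (S.lam 0) (S.lam S.h.succ)
  pure { S with lam := Function.update S.lam 0 p }

end DDState

namespace Problem

variable {ℓ : ℕ} (I : Problem F ℓ)

/-- The coefficient of `x^n` in the remainder of `a s_i` modulo `g_i`, where `g_i` is of the form
`x^t + c` with `t > 0`. -/
def remCoeff (i : Fin ℓ) (a : SkewPolynomial F) (n : ℕ) : Cost F :=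
  modCoeff (natDeg (I.g i)) ((I.g i).coeff 0) a (I.s i) n

/-- The coefficient of `x^η` in the entry `h` of the row number zero, which is
`(λ s_h mod g_h) x^{γ_h}` for `λ = λ_0 x^{-γ_0}`. -/
def ddCoeff (S : DDState F ℓ) : Cost F :=
  if S.η < I.γ S.h.succ then pure 0
  else I.remCoeff S.h (shiftDown (I.γ 0) (S.lam 0)) (S.η - I.γ S.h.succ).toNat

open Classical in
/-- The body of the loop. -/
def ddBody (S : DDState F ℓ) : Cost (DDState F ℓ) := do
  let α ← I.ddCoeff S
  let S' ←
    if α = 0 then pure S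
    else
      let P := if S.η < S.top S.h then S.swap α else (α, S)
      P.2.reduce P.1
  pure S'.decrement

/-- One iteration of the loop, which runs while `deg λ_0 ≤ η`. -/
def DDStep (S : DDState F ℓ) (c : Cost (DDState F ℓ)) : Prop :=
  (∀ n ∈ (S.lam 0).support, (n : ℤ) ≤ S.η) ∧ c = I.ddBody S

/-- The state before the loop, where `h` is the leading position of
`(x^{γ_0}, s_1 x^{γ_1}, …, s_ℓ x^{γ_ℓ})`. -/
def ddInit (h : Fin ℓ) : DDState F ℓ where
  lam := Pi.single 0 (X ^ I.γ 0)
  lead i := leadCoeff (I.g i)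
  top i := (I.γ i.succ : ℤ) + natDeg (I.g i)
  η := natDeg (I.shiftedM 0 h.succ)
  h := h

/-- The demand-driven algorithm; it returns the zeroth column of a shifted weak Popov form
of `M`. -/
def DDColumn (c : Cost (Fin (ℓ + 1) → SkewPolynomial F)) : Prop :=
  (leadPos (I.shiftedM 0) = (0 : Fin (ℓ + 1)) ∧ c = ⟨Pi.single 0 1, 0⟩) ∨
  ∃ h : Fin ℓ, leadPos (I.shiftedM 0) = h.succ ∧ ∃ d, Loop I.DDStep (I.ddInit h) d ∧
    c = ⟨fun j => shiftDown (I.γ 0) (d.val.lam j), d.ops⟩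

/-- Computes `(λ, λ s_1 mod g_1, …, λ s_ℓ mod g_ℓ)` from `λ`. -/
def completeRow (a : SkewPolynomial F) : Cost (Fin (ℓ + 1) → SkewPolynomial F) := do
  let ω ← Cost.pi fun i : Fin ℓ => Cost.forRange (fun n p => do
    let t ← I.remCoeff i a n
    pure (p.update n t)) (natDeg (I.g i)) 0
  pure (Matrix.vecCons a ω)

/-- Solving the problem by row reduction with the demand-driven algorithm: compute the zeroth column
`(λ_0, …, λ_ℓ)` of a shifted weak Popov form of `M`, and return the row that starts with `λ_0`. The
result holds the column and the row. -/
def DDRun (c : Cost ((Fin (ℓ + 1) → SkewPolynomial F) × (Fin (ℓ + 1) → SkewPolynomial F))) :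
    Prop :=
  ∃ d, I.DDColumn d ∧ c.val = (d.val, (I.completeRow (d.val 0)).val) ∧
    c.ops = d.ops + (I.completeRow (d.val 0)).ops

end Problem

end SkewShiftRegister

end

noncomputable section

namespace SkewShiftRegister

open SkewPolynomial

universe u

/-! ### Coefficients and degrees of skew polynomials -/

section Coefficients

variable {F : Type u} [Field F]

/-! The monomials of a vector are ordered first by degree, then by position (`key`), and the leading
position is the position of the largest one. Over `F[x; θ]` degrees add under multiplication,
because leading coefficients multiply up to an injective twist. Hence multiples of vectors with
different leading positions cannot cancel each other's leading monomials (`hasLead_sum_smul`).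

The row space of `M` consists exactly of the vectors that satisfy the congruences (`mem_span_M`),
and after `Φ_γ` the degree constraints say exactly that the leading position is `0`. So in a basis
with pairwise different leading positions, every feasible vector involves the row leading at `0`,
and that row has minimal `λ` (`IsRowBasis.isSolution`).

For the cost, each step lowers a potential made of degrees and positions. It is bounded below
because for every basis of the row space the sum of the row degrees is at least `∑ γ + ∑ deg g`
(`IsRowBasis.sum_le`). This plays the role of the degree of a determinant and is proved by counting
vectors over the finite field. Only row `0` of `Φ_γ(M)` can contribute to the excess over this
bound, which leaves `O(ℓ μ)` steps. A Mulders–Storjohann step rewrites a whole row, in `O(ℓ μ)`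
operations; a demand-driven step handles one coefficient and one entry of column `0`, in `O(μ)`
operations.

The state of the demand-driven algorithm is the visible part of a full basis `W` (`DDInvariant`).
Row `0` of `W` is kept reduced modulo the `g_i`, so that it can be recovered from `λ_0` alone. The
delicate point is that reducing row `0` must be a row operation by the other rows of `W`, although
the rows `(0, …, g_i, …, 0)` are no longer rows of `W`. The field `expand` of `DDRows` bounds the
multiple of row `0` occurring in them. It forces this multiple to be zero whenever a reduction
modulo `g_i` is needed (`DDRows.exists_reduced`), and the predictable degree property carries the
bound through swaps (`DDRows.swap`). -/

theorem coeff_finset_sum {ι : Type*} (s : Finset ι) (f : ι → SkewPolynomial F) (n : ℕ) :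
    (∑ i ∈ s, f i).coeff n = ∑ i ∈ s, (f i).coeff n := by
  classical
  induction s using Finset.induction_on with
  | empty => simp
  | insert a s ha ih => rw [Finset.sum_insert ha, Finset.sum_insert ha, coeff_add, ih]

theorem exists_coeff_ne_zero {p : SkewPolynomial F} (hp : p ≠ 0) : ∃ n, p.coeff n ≠ 0 := by
  by_contra! h
  exact hp (SkewPolynomial.ext fun n => by simp [h n])

theorem le_natDeg {p : SkewPolynomial F} {n : ℕ} (h : p.coeff n ≠ 0) : n ≤ natDeg p :=
  Finset.le_sup (f := id) (mem_support_iff.2 h)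

theorem coeff_eq_zero_of_natDeg_lt {p : SkewPolynomial F} {n : ℕ} (h : natDeg p < n) :
    p.coeff n = 0 := by
  by_contra hn
  exact absurd (le_natDeg hn) (by omega)

theorem natDeg_le {p : SkewPolynomial F} {d : ℕ} (h : ∀ n, p.coeff n ≠ 0 → n ≤ d) :
    natDeg p ≤ d :=
  Finset.sup_le fun n hn => h n (mem_support_iff.1 hn)

theorem natDeg_eq {p : SkewPolynomial F} {d : ℕ} (hd : p.coeff d ≠ 0)
    (h : ∀ n, p.coeff n ≠ 0 → n ≤ d) : natDeg p = d :=
  le_antisymm (natDeg_le h) (le_natDeg hd)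

@[simp] theorem natDeg_zero : natDeg (0 : SkewPolynomial F) = 0 := by simp [natDeg]

theorem leadCoeff_ne_zero {p : SkewPolynomial F} (hp : p ≠ 0) : leadCoeff p ≠ 0 := by
  obtain ⟨n, hn⟩ := exists_coeff_ne_zero hp
  obtain ⟨m, hm, h⟩ := Finset.exists_mem_eq_sup p.support ⟨n, mem_support_iff.2 hn⟩ id
  rw [leadCoeff, natDeg, h]
  exact mem_support_iff.1 hm

theorem deg_eq_natDeg {p : SkewPolynomial F} (hp : p ≠ 0) : deg p = (natDeg p : WithBot ℕ) := by
  apply le_antisymm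
  · exact Finset.max_le fun n hn => WithBot.coe_le_coe.2 (le_natDeg (mem_support_iff.1 hn))
  · exact Finset.le_max (mem_support_iff.2 (leadCoeff_ne_zero hp))

@[simp] theorem deg_zero : deg (0 : SkewPolynomial F) = ⊥ := by simp [deg]

theorem deg_eq_bot {p : SkewPolynomial F} : deg p = ⊥ ↔ p = 0 := by
  refine ⟨fun h => ?_, fun h => by simp [h]⟩
  by_contra hp
  rw [deg_eq_natDeg hp] at h
  exact WithBot.coe_ne_bot h

theorem natDeg_le_of_deg_le {p q : SkewPolynomial F} (h : deg p ≤ deg q) :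
    natDeg p ≤ natDeg q := by
  by_cases hp : p = 0
  · simp [hp]
  · have hq : q ≠ 0 := by
      rintro rfl
      rw [deg_zero, le_bot_iff, deg_eq_bot] at h
      exact hp h
    rw [deg_eq_natDeg hp, deg_eq_natDeg hq] at h
    exact_mod_cast h

variable [MulSemiringAction (Multiplicative ℕ) F]

/-- A ring homomorphism out of a field is injective. This keeps twisted leading coefficients
non-zero and allows dividing by them. -/
theorem phi_iterate_eq_zero (n : ℕ) {a : F} : φ^[n] a = 0 ↔ a = 0 := by
  rw [φ_iterate_apply]
  exact map_eq_zero (MulSemiringAction.toRingHom (Multiplicative ℕ) F (Multiplicative.ofAdd n))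

theorem coeff_mul (p q : SkewPolynomial F) (n : ℕ) :
    (p * q).coeff n = ∑ ij ∈ Finset.HasAntidiagonal.antidiagonal n,
      p.coeff ij.1 * φ^[ij.1] (q.coeff ij.2) := by
  simp only [φ_iterate_apply]
  let s : Finset (ℕ × ℕ) := Finset.HasAntidiagonal.antidiagonal n
  exact SkewMonoidAlgebra.coeff_mul_antidiagonal_of_finset p q (Multiplicative.ofAdd n)
    s (fun {x} => Finset.HasAntidiagonal.mem_antidiagonal (A := ℕ))

theorem coeff_monomial_mul (β n : ℕ) (a : F) (p : SkewPolynomial F) :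
    (monomial β a * p).coeff n = if β ≤ n then a * φ^[β] (p.coeff (n - β)) else 0 := by
  rw [coeff_mul]
  split_ifs with h
  · rw [Finset.sum_eq_single (β, n - β)]
    · simp [coeff_monomial]
    · rintro ⟨i, j⟩ hij hne
      rw [Finset.HasAntidiagonal.mem_antidiagonal] at hij
      rw [coeff_monomial, if_neg, zero_mul]
      rintro rfl
      exact hne (by simp only [Prod.mk.injEq, true_and]; simp only at hij; omega)
    · intro h'
      exact absurd (Finset.HasAntidiagonal.mem_antidiagonal.2 (by simp only; omega)) h'
  · refine Finset.sum_eq_zero fun ij hij => ?_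
    rw [Finset.HasAntidiagonal.mem_antidiagonal] at hij
    rw [coeff_monomial, if_neg (by omega), zero_mul]

theorem coeff_mul_X_pow (p : SkewPolynomial F) (w n : ℕ) :
    (p * X ^ w).coeff n = if w ≤ n then p.coeff (n - w) else 0 := by
  rw [coeff_mul, ← monomial_one_right_eq_X_pow]
  split_ifs with h
  · rw [Finset.sum_eq_single (n - w, w)]
    · simp [coeff_monomial]
    · rintro ⟨i, j⟩ hij hne
      rw [Finset.HasAntidiagonal.mem_antidiagonal] at hij
      rw [coeff_monomial, if_neg, (phi_iterate_eq_zero i).2 rfl, mul_zero]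
      rintro rfl
      exact hne (by simp only [Prod.mk.injEq, and_true]; simp only at hij; omega)
    · intro h'
      exact absurd (Finset.HasAntidiagonal.mem_antidiagonal.2 (by simp only; omega)) h'
  · refine Finset.sum_eq_zero fun ij hij => ?_
    rw [Finset.HasAntidiagonal.mem_antidiagonal] at hij
    rw [coeff_monomial, if_neg (by omega), (phi_iterate_eq_zero _).2 rfl, mul_zero]

theorem coeff_mul_ne_zero {p q : SkewPolynomial F} {n : ℕ} (h : (p * q).coeff n ≠ 0) :
    ∃ i j, i + j = n ∧ p.coeff i ≠ 0 ∧ q.coeff j ≠ 0 := by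
  rw [coeff_mul] at h
  obtain ⟨ij, hij, hne⟩ := Finset.exists_ne_zero_of_sum_ne_zero h
  refine ⟨ij.1, ij.2, Finset.HasAntidiagonal.mem_antidiagonal.1 hij, left_ne_zero_of_mul hne, fun h0 => ?_⟩
  exact right_ne_zero_of_mul hne ((phi_iterate_eq_zero _).2 h0)

theorem coeff_mul_of_le {p q : SkewPolynomial F} {m n : ℕ} (hp : ∀ k, p.coeff k ≠ 0 → k ≤ m)
    (hq : ∀ k, q.coeff k ≠ 0 → k ≤ n) :
    (p * q).coeff (m + n) = p.coeff m * φ^[m] (q.coeff n) := by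
  rw [coeff_mul]
  refine Finset.sum_eq_single_of_mem (m, n) (Finset.HasAntidiagonal.mem_antidiagonal.2 rfl) ?_
  rintro ⟨i, j⟩ hij hne
  rw [Finset.HasAntidiagonal.mem_antidiagonal] at hij
  simp only at hij ⊢
  by_cases hi : p.coeff i = 0
  · rw [hi, zero_mul]
  by_cases hj : q.coeff j = 0
  · rw [(phi_iterate_eq_zero _).2 hj, mul_zero]
  · have h1 := hp i hi
    have h2 := hq j hj
    exact absurd (by simp only [Prod.mk.injEq]; omega) hne

instance : IsDomain (SkewPolynomial F) :=
  haveI : NoZeroDivisors (SkewPolynomial F) := ⟨fun {p q} h => by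
    by_contra! hpq
    have h1 := coeff_mul_of_le (p := p) (q := q) (fun _ => le_natDeg) (fun _ => le_natDeg)
    rw [h, coeff_zero] at h1
    rcases mul_eq_zero.1 h1.symm with h2 | h2
    · exact leadCoeff_ne_zero hpq.1 h2
    · exact leadCoeff_ne_zero hpq.2 ((phi_iterate_eq_zero _).1 h2)⟩
  NoZeroDivisors.to_isDomain _

theorem natDeg_mul {p q : SkewPolynomial F} (hp : p ≠ 0) (hq : q ≠ 0) :
    natDeg (p * q) = natDeg p + natDeg q := by
  refine natDeg_eq ?_ fun n hn => ?_
  · rw [coeff_mul_of_le (fun _ => le_natDeg) (fun _ => le_natDeg)]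
    exact mul_ne_zero (leadCoeff_ne_zero hp)
      (mt (phi_iterate_eq_zero _).1 (leadCoeff_ne_zero hq))
  · obtain ⟨i, j, rfl, hi, hj⟩ := coeff_mul_ne_zero hn
    exact add_le_add (le_natDeg hi) (le_natDeg hj)

theorem natDeg_mul_X_pow {p : SkewPolynomial F} (hp : p ≠ 0) (w : ℕ) :
    natDeg (p * X ^ w) = natDeg p + w := by
  refine natDeg_eq ?_ fun n hn => ?_
  · rw [coeff_mul_X_pow, if_pos (by omega), Nat.add_sub_cancel]
    exact leadCoeff_ne_zero hp
  · rw [coeff_mul_X_pow] at hn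
    split_ifs at hn with h
    · have := le_natDeg hn
      omega
    · exact absurd rfl hn

theorem mul_X_pow_injective (w : ℕ) {p q : SkewPolynomial F} (h : p * X ^ w = q * X ^ w) :
    p = q := by
  ext n
  have := congrArg (fun r => r.coeff (n + w)) h
  simpa [coeff_mul_X_pow] using this

/-- Truncated subtraction in `shiftDown` sends all exponents up to `w` to `0`, but a multiple of `X
^ w` has no exponents below `w`, so nothing is merged. -/
theorem shiftDown_mul_X_pow (w : ℕ) (p : SkewPolynomial F) :
    shiftDown w (p * X ^ w) = p := by
  have key : ∀ q : SkewPolynomial F, ∀ n, (shiftDown w q).coeff n =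
      ∑ k ∈ q.support, if k - w = n then q.coeff k else 0 := by
    intro q n
    rw [shiftDown, sum_def, coeff_finset_sum]
    exact Finset.sum_congr rfl fun k _ => coeff_monomial
  ext n
  rw [key]
  rw [Finset.sum_eq_single (n + w)]
  · simp [coeff_mul_X_pow]
  · intro k hk hne
    rw [mem_support_iff, coeff_mul_X_pow] at hk
    rw [if_neg]
    split_ifs at hk with h
    · omega
    · exact absurd rfl hk
  · intro h
    rw [notMem_support_iff] at h
    simp [h]

end Coefficients

/-! ### The order of the monomials of a vector -/

section Lead

variable {F : Type u} [Field F] {m : ℕ}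

/-- Number of the monomial `x^n` in position `k`, monomials being ordered first by degree and then
by position. -/
def key (n : ℕ) (k : Fin m) : ℤ := (m : ℤ) * n + (k : ℕ)

/-- All monomials that occur in `v` have a number less than `b`. -/
def Below (b : ℤ) (v : Fin m → SkewPolynomial F) : Prop :=
  ∀ k n, (v k).coeff n ≠ 0 → key n k < b

/-- The leading monomial of `v` is `x^n` in position `k`. -/
def HasLead (v : Fin m → SkewPolynomial F) (n : ℕ) (k : Fin m) : Prop :=
  (v k).coeff n ≠ 0 ∧ Below (key n k + 1) v

/-- Positions are smaller than `m`, so `key` is lexicographic, like a number with last digit `k` in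
base `m`. -/
theorem key_lt_key {n n' : ℕ} {k k' : Fin m} :
    key n k < key n' k' ↔ n < n' ∨ n = n' ∧ k < k' := by
  have hk := k.isLt
  have hk' := k'.isLt
  unfold key
  rcases lt_trichotomy n n' with h | h | h
  · obtain ⟨d, rfl⟩ : ∃ d, n' = n + 1 + d := ⟨n' - (n + 1), by omega⟩
    simp only [h, true_or, iff_true]
    push_cast
    nlinarith [mul_nonneg (Int.natCast_nonneg m) (Int.natCast_nonneg d)]
  · subst h
    simp only [lt_irrefl, false_or, true_and, Fin.lt_def]
    omega
  · obtain ⟨d, rfl⟩ : ∃ d, n = n' + 1 + d := ⟨n - (n' + 1), by omega⟩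
    have : ¬ (n' + 1 + d < n') := by omega
    have h2 : ¬ (n' + 1 + d = n') := by omega
    simp only [this, h2, false_and, or_false, iff_false, not_lt]
    push_cast
    nlinarith [mul_nonneg (Int.natCast_nonneg m) (Int.natCast_nonneg d)]

theorem key_inj {n n' : ℕ} {k k' : Fin m} : key n k = key n' k' ↔ n = n' ∧ k = k' := by
  refine ⟨fun h => ?_, fun h => by rw [h.1, h.2]⟩
  have h1 := mt (key_lt_key (n := n) (n' := n') (k := k) (k' := k')).2 h.not_lt
  have h2 := mt (key_lt_key (n := n') (n' := n) (k := k') (k' := k)).2 h.not_gt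
  push Not at h1 h2
  have hn : n = n' := by omega
  exact ⟨hn, le_antisymm (h2.2 hn.symm) (h1.2 hn)⟩

theorem key_le_key {n n' : ℕ} {k k' : Fin m} :
    key n k ≤ key n' k' ↔ n < n' ∨ n = n' ∧ k ≤ k' := by
  rw [le_iff_lt_or_eq, key_lt_key, key_inj, le_iff_lt_or_eq]
  tauto

theorem key_add (n d : ℕ) (k : Fin m) : key (d + n) k = m * d + key n k := by
  unfold key
  push_cast
  ring

theorem Below.mono {b c : ℤ} {v : Fin m → SkewPolynomial F} (h : Below b v) (hbc : b ≤ c) :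
    Below c v :=
  fun k n hn => (h k n hn).trans_le hbc

theorem Below.zero (b : ℤ) : Below b (0 : Fin m → SkewPolynomial F) :=
  fun _ _ hn => absurd rfl hn

theorem Below.add {b : ℤ} {v w : Fin m → SkewPolynomial F} (hv : Below b v) (hw : Below b w) :
    Below b (v + w) := fun k n hn => by
  rw [Pi.add_apply, coeff_add] at hn
  by_cases h : (v k).coeff n = 0
  · exact hw k n fun h' => hn (by rw [h, h', add_zero])
  · exact hv k n h

theorem Below.sub {b : ℤ} {v w : Fin m → SkewPolynomial F} (hv : Below b v) (hw : Below b w) :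
    Below b (v - w) := fun k n hn => by
  rw [Pi.sub_apply, coeff_sub] at hn
  by_cases h : (v k).coeff n = 0
  · exact hw k n fun h' => hn (by rw [h, h', sub_zero])
  · exact hv k n h

theorem Below.sum {b : ℤ} {ι : Type*} (s : Finset ι) {v : ι → Fin m → SkewPolynomial F}
    (h : ∀ i ∈ s, Below b (v i)) : Below b (∑ i ∈ s, v i) := by
  classical
  induction s using Finset.induction_on with
  | empty => exact Below.zero b
  | insert a s ha ih =>
    rw [Finset.sum_insert ha]
    exact (h a (Finset.mem_insert_self a s)).add
      (ih fun i hi => h i (Finset.mem_insert_of_mem hi))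

theorem Below.lt_of_hasLead {b : ℤ} {v : Fin m → SkewPolynomial F} {n : ℕ} {k : Fin m}
    (hb : Below b v) (h : HasLead v n k) : key n k < b :=
  hb k n h.1

/-- Cancelling the leading monomial. -/
theorem Below.of_coeff_eq_zero {v : Fin m → SkewPolynomial F} {n : ℕ} {k : Fin m}
    (h : Below (key n k + 1) v) (h0 : (v k).coeff n = 0) : Below (key n k) v := fun k' n' hn' => by
  have h1 := h k' n' hn'
  refine lt_of_le_of_ne (by omega) fun he => ?_
  obtain ⟨rfl, rfl⟩ := key_inj.1 he
  exact hn' h0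

theorem HasLead.unique {v : Fin m → SkewPolynomial F} {n n' : ℕ} {k k' : Fin m}
    (h : HasLead v n k) (h' : HasLead v n' k') : n = n' ∧ k = k' := by
  have h1 := h.2.lt_of_hasLead h'
  have h2 := h'.2.lt_of_hasLead h
  exact key_inj.1 (by omega)

theorem HasLead.ne_zero {v : Fin m → SkewPolynomial F} {n : ℕ} {k : Fin m} (h : HasLead v n k) :
    v ≠ 0 := by
  rintro rfl
  exact h.1 rfl

theorem HasLead.natDeg_eq {v : Fin m → SkewPolynomial F} {n : ℕ} {k : Fin m}
    (h : HasLead v n k) : natDeg (v k) = n :=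
  SkewShiftRegister.natDeg_eq h.1 fun n' hn' => by
    have := h.2 k n' hn'
    rw [Int.lt_add_one_iff, key_le_key] at this
    omega

theorem HasLead.le {v : Fin m → SkewPolynomial F} {n : ℕ} {k : Fin m}
    (h : HasLead v n k) {k' : Fin m} {n' : ℕ} (hn' : (v k').coeff n' ≠ 0) : n' ≤ n := by
  have := h.2 k' n' hn'
  rw [Int.lt_add_one_iff, key_le_key] at this
  omega

theorem hasLead_iff {v : Fin m → SkewPolynomial F} {n : ℕ} {k : Fin m} :
    HasLead v n k ↔ (v k).coeff n ≠ 0 ∧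
      ∀ k' n', (v k').coeff n' ≠ 0 → n' < n ∨ n' = n ∧ k' ≤ k := by
  simp only [HasLead, Below, Int.lt_add_one_iff, key_le_key]

theorem HasLead.add_below {v w : Fin m → SkewPolynomial F} {n : ℕ} {k : Fin m}
    (h : HasLead v n k) (hw : Below (key n k) w) : HasLead (v + w) n k := by
  refine ⟨?_, h.2.add (hw.mono (by omega))⟩
  rw [Pi.add_apply, coeff_add]
  have : (w k).coeff n = 0 := by
    by_contra hne
    exact absurd (hw k n hne) (lt_irrefl _)
  rw [this, add_zero]
  exact h.1

theorem exists_hasLead {v : Fin m → SkewPolynomial F} (hv : v ≠ 0) : ∃ n k, HasLead v n k := by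
  classical
  let s : Finset (Σ _ : Fin m, ℕ) := Finset.univ.sigma fun k => (v k).support
  have hs : s.Nonempty := by
    by_contra h
    apply hv
    funext k
    by_contra hk
    obtain ⟨n, hn⟩ := exists_coeff_ne_zero hk
    exact h ⟨⟨k, n⟩, by simpa [s] using hn⟩
  obtain ⟨x, hx, hmax⟩ := s.exists_max_image (fun x => key x.2 x.1) hs
  refine ⟨x.2, x.1, by simpa [s] using hx, fun k n hn => ?_⟩
  have := hmax ⟨k, n⟩ (by simpa [s] using hn)
  simp only at this
  omega

/-- The leading position is the position of the leading monomial. -/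
theorem leadPos_eq_iff {v : Fin m → SkewPolynomial F} {k : Fin m} :
    leadPos v = k ↔ ∃ n, HasLead v n k := by
  classical
  have main : ∀ n k, HasLead v n k → leadPos v = k := by
    intro n k h
    have hk : v k ≠ 0 := fun h0 => h.1 (by rw [h0]; rfl)
    apply le_antisymm
    · refine Finset.max_le fun i hi => WithBot.coe_le_coe.2 ?_
      rw [Finset.mem_filter] at hi
      obtain ⟨-, hi, hmax⟩ := hi
      have h1 := hmax k
      rw [deg_eq_natDeg hi, deg_eq_natDeg hk, h.natDeg_eq, Nat.cast_le] at h1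
      rcases (hasLead_iff.1 h).2 i _ (leadCoeff_ne_zero hi) with h2 | h2
      · omega
      · exact h2.2
    · refine Finset.le_max (Finset.mem_filter.2 ⟨Finset.mem_univ _, hk, fun j => ?_⟩)
      by_cases hj : v j = 0
      · simp [hj]
      · rw [deg_eq_natDeg hj, deg_eq_natDeg hk, h.natDeg_eq, Nat.cast_le]
        exact h.le (leadCoeff_ne_zero hj)
  refine ⟨fun h => ?_, fun ⟨n, h⟩ => main n k h⟩
  have hv : v ≠ 0 := by
    rintro rfl
    simp [leadPos] at h
  obtain ⟨n, k', h'⟩ := exists_hasLead hv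
  have := (main n k' h').symm.trans h
  rw [WithBot.coe_inj] at this
  exact ⟨n, this ▸ h'⟩

variable [MulSemiringAction (Multiplicative ℕ) F]

/-- Raising an exponent by `d` adds `m * d` to its `key`, whatever the position. -/
theorem Below.smul {b : ℤ} {v : Fin m → SkewPolynomial F} (h : Below b v)
    {a : SkewPolynomial F} {d : ℕ} (ha : natDeg a ≤ d) : Below (m * d + b) (a • v) :=
  fun k n hn => by
    obtain ⟨i, j, rfl, hi, hj⟩ := coeff_mul_ne_zero hn
    have h1 := h k j hj
    have h2 : i ≤ d := (le_natDeg hi).trans ha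
    rw [key_add]
    have : (m : ℤ) * i ≤ m * d := by gcongr
    omega

theorem HasLead.smul {v : Fin m → SkewPolynomial F} {n : ℕ} {k : Fin m} (h : HasLead v n k)
    {a : SkewPolynomial F} (ha : a ≠ 0) : HasLead (a • v) (natDeg a + n) k := by
  refine ⟨?_, ?_⟩
  · rw [Pi.smul_apply, smul_eq_mul, coeff_mul_of_le (fun _ => le_natDeg)]
    · exact mul_ne_zero (leadCoeff_ne_zero ha) (mt (phi_iterate_eq_zero _).1 h.1)
    · exact fun n' hn' => h.le hn'
  · rw [key_add, add_assoc]
    exact h.2.smul le_rfl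

/-- The predictable degree property: there is no cancellation between multiples of vectors with
different leading positions. -/
theorem hasLead_sum_smul {ι : Type*} [Fintype ι] {V : ι → Fin m → SkewPolynomial F} {d : ι → ℕ}
    {π : ι → Fin m} (hπ : Function.Injective π) (hV : ∀ i, HasLead (V i) (d i) (π i))
    {a : ι → SkewPolynomial F} (ha : a ≠ 0) :
    ∃ j, a j ≠ 0 ∧ HasLead (∑ i, a i • V i) (natDeg (a j) + d j) (π j) ∧
      ∀ i, a i ≠ 0 → key (natDeg (a i) + d i) (π i) ≤ key (natDeg (a j) + d j) (π j) := by
  classical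
  let s : Finset ι := Finset.univ.filter fun i => a i ≠ 0
  have hs : s.Nonempty := by
    obtain ⟨i, hi⟩ := Function.ne_iff.1 ha
    exact ⟨i, by simpa [s] using hi⟩
  obtain ⟨j, hj, hmax⟩ := s.exists_max_image (fun i => key (natDeg (a i) + d i) (π i)) hs
  have hj' : a j ≠ 0 := by simpa [s] using hj
  have hmax' : ∀ i, a i ≠ 0 →
      key (natDeg (a i) + d i) (π i) ≤ key (natDeg (a j) + d j) (π j) :=
    fun i hi => hmax i (by simpa [s] using hi)
  refine ⟨j, hj', ?_, hmax'⟩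
  rw [← Finset.add_sum_erase _ _ (Finset.mem_univ j)]
  refine ((hV j).smul hj').add_below (Below.sum _ fun i hi => ?_)
  by_cases hi0 : a i = 0
  · rw [hi0, zero_smul]
    exact Below.zero _
  · refine ((hV i).smul hi0).2.mono ?_
    -- A tie with the maximal term would force equal positions, which injectivity of `π` excludes.
    refine lt_of_le_of_ne (hmax' i hi0) fun he => ?_
    exact Finset.ne_of_mem_erase hi (hπ (key_inj.1 he).2)

/-- By the predictable degree property the largest term survives in the sum, so a bound for the sum
bounds each term. -/
theorem key_lt_of_below_sum_smul {ι : Type*} [Fintype ι] {V : ι → Fin m → SkewPolynomial F}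
    {d : ι → ℕ} {π : ι → Fin m} (hπ : Function.Injective π)
    (hV : ∀ i, HasLead (V i) (d i) (π i)) {a : ι → SkewPolynomial F} {b : ℤ}
    (hb : Below b (∑ i, a i • V i)) {i : ι} (hi : a i ≠ 0) :
    key (natDeg (a i) + d i) (π i) < b := by
  obtain ⟨j, -, hl, hmax⟩ := hasLead_sum_smul hπ hV (a := a) fun h => hi (congrFun h i)
  exact (hmax i hi).trans_lt (hb.lt_of_hasLead hl)

/-- `Φ_w` as a linear map. -/
def shiftLinear (w : Fin m → ℕ) :
    (Fin m → SkewPolynomial F) →ₗ[SkewPolynomial F] (Fin m → SkewPolynomial F) where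
  toFun := shift w
  map_add' u v := funext fun i => add_mul (u i) (v i) _
  map_smul' a v := funext fun i => mul_assoc a (v i) _

theorem shiftLinear_injective (w : Fin m → ℕ) :
    Function.Injective (shiftLinear (F := F) w) := fun u v h => by
  funext i
  exact mul_X_pow_injective (w i) (congrFun h i)

end Lead

/-! ### Counting operations -/

section CostLemmas

namespace Cost

variable {α β : Type u}

@[simp] theorem val_pure (a : α) : (pure a : Cost α).val = a := rfl
@[simp] theorem ops_pure (a : α) : (pure a : Cost α).ops = 0 := rfl
@[simp] theorem val_bind (c : Cost α) (f : α → Cost β) : (c >>= f).val = (f c.val).val := rfl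
@[simp] theorem ops_bind (c : Cost α) (f : α → Cost β) :
    (c >>= f).ops = c.ops + (f c.val).ops := rfl
@[simp] theorem val_pi {n : ℕ} (f : Fin n → Cost α) : (pi f).val = fun k => (f k).val := rfl
@[simp] theorem ops_pi {n : ℕ} (f : Fin n → Cost α) : (pi f).ops = ∑ k, (f k).ops := rfl

variable {σ : Type u}

@[simp] theorem forRange_zero (body : ℕ → σ → Cost σ) (s : σ) :
    forRange body 0 s = pure s := rfl

@[simp] theorem forRange_succ (body : ℕ → σ → Cost σ) (n : ℕ) (s : σ) :
    forRange body (n + 1) s = forRange body n s >>= body n := rfl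

theorem ops_forRange_le {body : ℕ → σ → Cost σ} {B : ℕ} (h : ∀ k s, (body k s).ops ≤ B) (n : ℕ)
    (s : σ) : (forRange body n s).ops ≤ n * B := by
  induction n with
  | zero => simp
  | succ n ih =>
    rw [forRange_succ, ops_bind, Nat.succ_mul]
    exact add_le_add ih (h _ _)

end Cost

variable {σ : Type u} {step : σ → Cost σ → Prop}

theorem terminates_of_potential {Inv : σ → Prop} {pot : σ → ℕ}
    (h : ∀ s c, Inv s → step s c → Inv c.val ∧ pot c.val < pot s) {s : σ} (hs : Inv s) :
    Terminates step s := by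
  induction hn : pot s using Nat.strong_induction_on generalizing s with
  | _ n ih =>
    refine Acc.intro _ ?_
    rintro t ⟨c, hc, rfl⟩
    obtain ⟨h1, h2⟩ := h s c hs hc
    exact ih _ (hn ▸ h2) h1 rfl

theorem Terminates.exists_loop {s : σ} (h : Terminates step s) : ∃ d, Loop step s d := by
  induction h with
  | intro s _ ih =>
    by_cases hs : ∃ c, step s c
    · obtain ⟨c, hc⟩ := hs
      obtain ⟨d, hd⟩ := ih c.val ⟨c, hc, rfl⟩
      exact ⟨_, Loop.next s c d hc hd⟩
    · push Not at hs
      exact ⟨_, Loop.halt s hs⟩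

theorem Loop.invariant {s : σ} {d : Cost σ} (hl : Loop step s d) {Inv : σ → Prop}
    (h : ∀ s c, Inv s → step s c → Inv c.val) (hs : Inv s) : Inv d.val := by
  induction hl with
  | halt s _ => exact hs
  | next s c d hc _ ih => exact ih (h s c hs hc)

theorem Loop.not_step {s : σ} {d : Cost σ} (hl : Loop step s d) : ∀ c, ¬ step d.val c := by
  induction hl with
  | halt s h => exact h
  | next s c d hc _ ih => exact ih

/-- If each step lowers the potential and uses at most `C` operations, then the number of
operations is at most `C` times the loss of potential. -/
theorem Loop.ops_le {s : σ} {d : Cost σ} (hl : Loop step s d) {Inv : σ → Prop} {pot : σ → ℕ}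
    {C : ℕ}
    (h : ∀ s c, Inv s → step s c → Inv c.val ∧ pot c.val < pot s ∧ c.ops ≤ C) (hs : Inv s) :
    d.ops + C * pot d.val ≤ C * pot s := by
  induction hl with
  | halt s _ => simp
  | next s c d hc _ ih =>
    obtain ⟨h1, h2, h3⟩ := h s c hs hc
    have h4 := ih h1
    have h5 : C * (pot c.val + 1) ≤ C * pot s := Nat.mul_le_mul_left _ h2
    simp only
    rw [Nat.mul_add, mul_one] at h5
    omega

end CostLemmas

section FieldOperations

variable {F : Type u} [Field F]

@[simp] theorem val_add (a b : F) : (add a b).val = a + b := rfl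
@[simp] theorem val_sub (a b : F) : (sub a b).val = a - b := rfl
@[simp] theorem val_mul (a b : F) : (mul a b).val = a * b := rfl
@[simp] theorem val_div (a b : F) : (div a b).val = a / b := rfl
@[simp] theorem ops_add (a b : F) : (add a b).ops = 1 := rfl
@[simp] theorem ops_sub (a b : F) : (sub a b).ops = 1 := rfl
@[simp] theorem ops_mul (a b : F) : (mul a b).ops = 1 := rfl
@[simp] theorem ops_div (a b : F) : (div a b).ops = 1 := rfl

end FieldOperations

/-! ### The arithmetic of skew polynomials -/

section Arithmetic

variable {F : Type u} [Field F] [MulSemiringAction (Multiplicative ℕ) F]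

@[simp] theorem val_frob (i : ℕ) (a : F) : (frob i a).val = φ^[i] a := rfl
@[simp] theorem ops_frob (i : ℕ) (a : F) : (frob i a).ops = 1 := rfl

theorem subMulShift_val (α : F) (β : ℕ) (p q : SkewPolynomial F) :
    (subMulShift α β p q).val = p - monomial β α * q := by
  -- Pass `k` alters only the exponent `k + β`, so each pass still reads an original coefficient of
  -- `p`.
  have key : ∀ N n, (Cost.forRange (fun k (r : SkewPolynomial F) => do
      let t ← frob β (q.coeff k)
      let t ← mul α t
      let t ← sub (r.coeff (k + β)) t
      pure (r.update (k + β) t)) N p).val.coeff n =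
        p.coeff n - if β ≤ n ∧ n - β < N then α * φ^[β] (q.coeff (n - β)) else 0 := by
    intro N
    induction N with
    | zero => simp
    | succ N ih =>
      intro n
      simp only [Cost.forRange_succ, Cost.val_bind, Cost.val_pure, coeff_update,
        Function.update_apply, ih, val_frob, val_mul, val_sub]
      by_cases hn : n = N + β
      · subst hn
        simp
      · rw [if_neg hn]
        congr 1
        refine if_congr ?_ rfl rfl
        omega
  ext n
  rw [subMulShift, key, coeff_sub, coeff_monomial_mul]
  by_cases h : β ≤ n
  · by_cases h' : n - β < natDeg q + 1
    · rw [if_pos ⟨h, h'⟩, if_pos h]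
    · rw [if_neg (fun h2 => h' h2.2), if_pos h, coeff_eq_zero_of_natDeg_lt (p := q) (by omega),
        (phi_iterate_eq_zero _).2 rfl, mul_zero]
  · rw [if_neg (fun h2 => h h2.1), if_neg h]

theorem subMulShift_ops (α : F) (β : ℕ) (p q : SkewPolynomial F) :
    (subMulShift α β p q).ops ≤ 3 * (natDeg q + 1) := by
  rw [mul_comm]
  exact Cost.ops_forRange_le (fun k s => by simp) _ _

theorem mulCoeff_val (a s : SkewPolynomial F) (m : ℕ) : (mulCoeff a s m).val = (a * s).coeff m := by
  have key : ∀ N, (Cost.forRange (fun j acc => do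
      let t ← frob (m - j) (s.coeff j)
      let t ← mul (a.coeff (m - j)) t
      add acc t) N (0 : F)).val =
        ∑ j ∈ Finset.range N, a.coeff (m - j) * φ^[m - j] (s.coeff j) := by
    intro N
    induction N with
    | zero => simp
    | succ N ih =>
      simp only [Cost.forRange_succ, Cost.val_bind, ih, val_frob, val_mul, val_add,
        Finset.sum_range_succ]
  rw [mulCoeff, key, coeff_mul, ← Finset.Nat.sum_antidiagonal_swap,
    Finset.Nat.sum_antidiagonal_eq_sum_range_succ_mk]
  refine Finset.sum_subset (fun j hj => ?_) fun j hj hj' => ?_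
  · simp only [Finset.mem_range] at hj ⊢
    omega
  · simp only [Finset.mem_range] at hj hj'
    rw [coeff_eq_zero_of_natDeg_lt (p := s) (by omega), (phi_iterate_eq_zero _).2 rfl, mul_zero]

theorem mulCoeff_ops (a s : SkewPolynomial F) (m : ℕ) :
    (mulCoeff a s m).ops ≤ 3 * (natDeg s + 1) := by
  refine (Cost.ops_forRange_le (B := 3) (fun k s => by simp) _ _).trans ?_
  have := min_le_right m (natDeg s)
  omega

/-- The weight `∏_{j < k} (-θ^(n + j t)(c))`. -/
def modWeight (t : ℕ) (c : F) (n k : ℕ) : F := ∏ j ∈ Finset.range k, (-φ^[n + j * t] c)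

theorem modCoeff_val {t : ℕ} {c : F} {n : ℕ} (hn : n < t) (a s : SkewPolynomial F) :
    (modCoeff t c a s n).val =
      ∑ k ∈ Finset.range ((natDeg a + natDeg s - n) / t + 1),
        (a * s).coeff (n + k * t) * modWeight t c n k := by
  have key : ∀ N, (Cost.forRange (fun k (r : F × F) => do
      let q ← mulCoeff a s (n + k * t)
      let q ← mul q r.2
      let acc ← add r.1 q
      let e ← frob (n + k * t) c
      let e ← mul r.2 e
      let e ← sub 0 e
      pure (acc, e)) N (0, 1)).val =
        (∑ k ∈ Finset.range N, (a * s).coeff (n + k * t) * modWeight t c n k,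
          modWeight t c n N) := by
    intro N
    induction N with
    | zero => simp [modWeight]
    | succ N ih =>
      simp only [Cost.forRange_succ, Cost.val_bind, ih, Cost.val_pure, mulCoeff_val,
        val_frob, val_mul, val_add, val_sub, Finset.sum_range_succ, modWeight, Finset.prod_range_succ, zero_sub, mul_neg]
  rw [modCoeff, if_neg (by omega), Cost.val_bind, key, Cost.val_pure]

theorem modCoeff_eq_zero {t : ℕ} {c : F} {n : ℕ} (hn : t ≤ n) (a s : SkewPolynomial F) :
    (modCoeff t c a s n).val = 0 := by
  rw [modCoeff, if_pos hn]
  rfl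

theorem modCoeff_ops {t B : ℕ} (ht : 0 < t) (htB : t ≤ B) (c : F) {a s : SkewPolynomial F}
    (ha : natDeg a ≤ B) (hs : natDeg s ≤ t) (n : ℕ) : (modCoeff t c a s n).ops ≤ 33 * B := by
  rw [modCoeff]
  split_ifs with hn
  · simp
  · rw [Cost.ops_bind, Cost.ops_pure, add_zero]
    refine (Cost.ops_forRange_le (B := 3 * (natDeg s + 1) + 5) (fun k r => ?_) _ _).trans ?_
    · simp only [Cost.ops_bind, Cost.ops_pure, ops_mul, ops_add, ops_frob, ops_sub]
      have := mulCoeff_ops a s (n + k * t)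
      omega
    -- There are about `2B / t` exponents in the residue class, and each convolution costs `O(t)`.
    -- The four summands below are at most `6B`, `16B`, `3B` and `8B`.
    · set q := (natDeg a + natDeg s - n) / t
      have h1 : q * t ≤ 2 * B := (Nat.div_mul_le_self _ _).trans (by omega)
      have h2 : q ≤ q * t := Nat.le_mul_of_pos_right _ ht
      have h3 : q * natDeg s ≤ q * t := Nat.mul_le_mul_left _ hs
      calc (q + 1) * (3 * (natDeg s + 1) + 5)
          = 3 * (q * natDeg s) + 8 * q + 3 * natDeg s + 8 := by ring
        _ ≤ 33 * B := by omega

/-- Iterates `b x^(m + t) = b x^m (x^t + c) - b θ^m(c) x^m`, each round contributing one factor of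
the weight. -/
theorem exists_monomial_eq_mod (t : ℕ) (c : F) (n k : ℕ) (b : F) :
    ∃ d : SkewPolynomial F, monomial (n + k * t) b =
      monomial n (b * modWeight t c n k) + d * (X ^ t + C c) := by
  induction k generalizing b with
  | zero => exact ⟨0, by simp [modWeight]⟩
  | succ k ih =>
    obtain ⟨d, hd⟩ := ih (b * -φ^[n + k * t] c)
    refine ⟨d + monomial (n + k * t) b, ?_⟩
    have h1 : b * modWeight t c n (k + 1) = b * -φ^[n + k * t] c * modWeight t c n k := by
      rw [modWeight, Finset.prod_range_succ, modWeight]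
      ring
    have h2 : n + (k + 1) * t = n + k * t + t := by ring
    rw [h1, h2, add_mul, ← add_assoc, ← hd, mul_add, monomial_mul_X_pow, monomial_mul_C, mul_neg,
      monomial_neg]
    abel

/-- `modCoeff` computes the coefficients of the remainder. -/
theorem exists_modCoeff_eq_coeff {t : ℕ} (ht : 0 < t) (c : F) (a s : SkewPolynomial F) :
    ∃ r : SkewPolynomial F, ModEq (X ^ t + C c) (a * s) r ∧ (∀ n, r.coeff n ≠ 0 → n < t) ∧
      ∀ n, (modCoeff t c a s n).val = r.coeff n := by
  classical
  -- The number of exponents `n + k * t` that do not exceed the degree bound for `a * s`.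
  let K : ℕ → ℕ := fun n => (natDeg a + natDeg s - n) / t + 1
  have hK : ∀ n k, (a * s).coeff (n + k * t) ≠ 0 → k < K n := by
    intro n k h
    obtain ⟨i, j, hij, hi, hj⟩ := coeff_mul_ne_zero h
    have h1 := le_natDeg hi
    have h2 := le_natDeg hj
    rw [Nat.lt_succ_iff, Nat.le_div_iff_mul_le ht]
    omega
  choose d hd using exists_monomial_eq_mod (F := F) t c
  let r : SkewPolynomial F := ∑ n ∈ Finset.range t, ∑ k ∈ Finset.range (K n),
    monomial n ((a * s).coeff (n + k * t) * modWeight t c n k)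
  have hr : ∀ n, r.coeff n = if n < t then
      ∑ k ∈ Finset.range (K n), (a * s).coeff (n + k * t) * modWeight t c n k else 0 := by
    intro n
    simp only [r, coeff_finset_sum, coeff_monomial]
    split_ifs with h
    · rw [Finset.sum_eq_single_of_mem n (Finset.mem_range.2 h) fun i _ hi => by simp [hi]]
      simp
    · refine Finset.sum_eq_zero fun i hi => Finset.sum_eq_zero fun k _ => if_neg ?_
      rintro rfl
      exact h (Finset.mem_range.1 hi)
  -- The monomials are sorted by residue class: exponent `m` sits at `n = m % t`, `k = m / t`.
  have hp : a * s = ∑ n ∈ Finset.range t, ∑ k ∈ Finset.range (K n),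
      monomial (n + k * t) ((a * s).coeff (n + k * t)) := by
    ext m
    simp only [coeff_finset_sum, coeff_monomial]
    by_cases hm : (a * s).coeff m = 0
    · rw [hm]
      refine (Finset.sum_eq_zero fun n _ => Finset.sum_eq_zero fun k _ => ?_).symm
      split_ifs with h
      · rw [h, hm]
      · rfl
    · have hm' : m % t + m / t * t = m := Nat.mod_add_div' m t
      rw [Finset.sum_eq_single_of_mem (m % t) (Finset.mem_range.2 (Nat.mod_lt m ht)),
        Finset.sum_eq_single_of_mem (m / t) (Finset.mem_range.2 (hK _ _ (by rwa [hm'])))]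
      · rw [if_pos hm', hm']
      · intro k _ hk
        refine if_neg fun h => hk ?_
        exact Nat.eq_of_mul_eq_mul_right ht (by omega)
      · intro n hn hne
        refine Finset.sum_eq_zero fun k _ => if_neg fun h => hne ?_
        rw [← h, Nat.add_mul_mod_self_right, Nat.mod_eq_of_lt (Finset.mem_range.1 hn)]
  refine ⟨r, ⟨∑ n ∈ Finset.range t, ∑ k ∈ Finset.range (K n),
    d n k ((a * s).coeff (n + k * t)), ?_⟩, fun n hn => ?_, fun n => ?_⟩
  · conv_lhs => rw [hp]
    simp only [r, Finset.sum_mul, ← Finset.sum_add_distrib, ← hd]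
  · rw [hr] at hn
    by_contra h
    exact hn (if_neg h)
  · rw [hr]
    split_ifs with h
    · exact modCoeff_val h a s
    · exact modCoeff_eq_zero (by omega) a s

/-- Remainders are unique. -/
theorem ModEq.eq_of_lt {g p r r' : SkewPolynomial F} (h : ModEq g p r) (h' : ModEq g p r')
    (hr : ∀ n, r.coeff n ≠ 0 → n < natDeg g) (hr' : ∀ n, r'.coeff n ≠ 0 → n < natDeg g) :
    r = r' := by
  obtain ⟨d, rfl⟩ := h
  obtain ⟨d', hd⟩ := h'
  have h1 : r - r' = (d' - d) * g := by
    rw [sub_mul, eq_sub_iff_add_eq, sub_add_eq_add_sub, hd, add_sub_cancel_left]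
  -- A non-zero multiple of `g` has degree at least `natDeg g`, where both remainders have no
  -- coefficients.
  by_contra hne
  have h2 : (d' - d) * g ≠ 0 := h1 ▸ sub_ne_zero.2 hne
  have h3 := natDeg_mul (left_ne_zero_of_mul h2) (right_ne_zero_of_mul h2)
  have h4 := leadCoeff_ne_zero h2
  rw [leadCoeff, h3, ← h1, coeff_sub] at h4
  by_cases h5 : r.coeff (natDeg (d' - d) + natDeg g) = 0
  · rw [h5, zero_sub, neg_ne_zero] at h4
    have := hr' _ h4
    omega
  · have := hr _ h5
    omega

end Arithmetic

/-! ### Elementary row operations -/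

section RowOperations

variable {R E ι : Type*} [Ring R] [AddCommGroup E] [Module R E] [Fintype ι] [DecidableEq ι]

theorem sum_smul_update_add (V : ι → E) (j : ι) (a c : ι → R) :
    ∑ i, a i • Function.update V j (V j + ∑ i, c i • V i) i =
      ∑ i, (a i + a j * c i) • V i := by
  have h : ∀ i, a i • Function.update V j (V j + ∑ i, c i • V i) i =
      a i • V i + if i = j then a j • ∑ i, c i • V i else 0 := by
    intro i
    by_cases hi : i = j
    · subst hi
      simp
    · simp [hi]
  simp only [h, Finset.sum_add_distrib, Finset.sum_ite_eq', Finset.mem_univ, if_true,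
    Finset.smul_sum, add_smul, mul_smul]

/-- A relation among the new rows is one among the old rows with coefficients `a i + a j * c i`.
Since `c j = 0`, row `j` gives `a j = 0` first, and then the other coefficients vanish. -/
theorem linearIndependent_update_add {V : ι → E} (hV : LinearIndependent R V) {j : ι} {c : ι → R}
    (hc : c j = 0) : LinearIndependent R (Function.update V j (V j + ∑ i, c i • V i)) := by
  rw [Fintype.linearIndependent_iff] at hV ⊢
  intro a ha
  rw [sum_smul_update_add] at ha
  have h := hV _ ha
  have hj : a j = 0 := by simpa [hc] using h j
  intro i
  simpa [hj] using h i

theorem span_update_add (V : ι → E) {j : ι} {c : ι → R} (hc : c j = 0) :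
    Submodule.span R (Set.range (Function.update V j (V j + ∑ i, c i • V i))) =
      Submodule.span R (Set.range V) := by
  apply le_antisymm
  · rw [Submodule.span_le]
    rintro _ ⟨i, rfl⟩
    have hm : ∀ i, V i ∈ Submodule.span R (Set.range V) :=
      fun i => Submodule.subset_span ⟨i, rfl⟩
    by_cases hi : i = j
    · subst hi
      simp only [Function.update_self]
      exact Submodule.add_mem _ (hm i)
        (Submodule.sum_mem _ fun k _ => Submodule.smul_mem _ _ (hm k))
    · simp only [Function.update_of_ne hi]
      exact hm i
  · rw [Submodule.span_le]
    rintro _ ⟨i, rfl⟩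
    set V' := Function.update V j (V j + ∑ i, c i • V i) with hV'
    have hm : ∀ i, V' i ∈ Submodule.span R (Set.range V') :=
      fun i => Submodule.subset_span ⟨i, rfl⟩
    by_cases hi : i = j
    · subst hi
      have h1 : V i = V' i - ∑ k, c k • V' k := by
        have h2 : ∀ k, c k • V' k = c k • V k := by
          intro k
          by_cases hk : k = i
          · rw [hk, hc, zero_smul, zero_smul]
          · rw [hV', Function.update_of_ne hk]
        simp only [h2]
        rw [hV', Function.update_self, add_sub_cancel_right]
      rw [h1]
      exact Submodule.sub_mem _ (hm i)
        (Submodule.sum_mem _ fun k _ => Submodule.smul_mem _ _ (hm k))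
    · have := hm i
      rwa [hV', Function.update_of_ne hi, ← hV'] at this

end RowOperations

namespace Problem

section Entries

variable {F : Type u} [Field F] {ℓ : ℕ} (I : Problem F ℓ)

@[simp] theorem M_zero_zero : I.M 0 0 = 1 := rfl
@[simp] theorem M_zero_succ (i : Fin ℓ) : I.M 0 i.succ = I.s i := rfl
@[simp] theorem M_succ_zero (i : Fin ℓ) : I.M i.succ 0 = 0 := rfl
@[simp] theorem M_succ_succ (i k : Fin ℓ) :
    I.M i.succ k.succ = (Pi.single i (I.g i) : Fin ℓ → SkewPolynomial F) k := rfl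

end Entries

variable {F : Type u} [Field F] [MulSemiringAction (Multiplicative ℕ) F] {ℓ : ℕ} (I : Problem F ℓ)

/-! ### The row space -/

/-- The row space of `M` is the module of solutions of the congruences. -/
theorem mem_span_M {u : Fin (ℓ + 1) → SkewPolynomial F} :
    u ∈ Submodule.span (SkewPolynomial F) (Set.range I.M) ↔
      ∀ i, ModEq (I.g i) (u 0 * I.s i) (u i.succ) := by
  refine ⟨fun hu => ?_, fun hu => ?_⟩
  · intro i
    induction hu using Submodule.span_induction with
    | mem x hx =>
      obtain ⟨j, rfl⟩ := hx
      refine Fin.cases ?_ (fun k => ?_) j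
      · exact ⟨0, by simp⟩
      · by_cases hik : i = k
        · subst hik
          exact ⟨-1, by simp⟩
        · exact ⟨0, by simp [hik]⟩
    | zero => exact ⟨0, by simp⟩
    | add x y _ _ hx hy =>
      obtain ⟨d, hd⟩ := hx
      obtain ⟨e, he⟩ := hy
      refine ⟨d + e, ?_⟩
      rw [Pi.add_apply, Pi.add_apply, add_mul, hd, he, add_mul]
      abel
    | smul a x _ hx =>
      obtain ⟨d, hd⟩ := hx
      refine ⟨a * d, ?_⟩
      rw [Pi.smul_apply, Pi.smul_apply, smul_eq_mul, smul_eq_mul, mul_assoc, hd, mul_add,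
        mul_assoc]
  · choose d hd using hu
    have h : u = u 0 • I.M 0 + ∑ k, (-d k) • I.M k.succ := by
      funext i
      refine Fin.cases ?_ (fun i => ?_) i
      · simp
      · simp only [Pi.add_apply, Pi.smul_apply, smul_eq_mul, M_zero_succ, Finset.sum_apply,
          M_succ_succ]
        rw [Finset.sum_eq_single_of_mem i (Finset.mem_univ i)]
        · rw [Pi.single_eq_same, hd]
          simp
        · intro k _ hk
          rw [Pi.single_eq_of_ne hk.symm, mul_zero]
    rw [h]
    exact Submodule.add_mem _ (Submodule.smul_mem _ _ (Submodule.subset_span ⟨0, rfl⟩))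
      (Submodule.sum_mem _ fun k _ => Submodule.smul_mem _ _ (Submodule.subset_span ⟨_, rfl⟩))

/-- The row space of `Φ_γ(M)`. -/
def rowSpace : Submodule (SkewPolynomial F) (Fin (ℓ + 1) → SkewPolynomial F) :=
  Submodule.span _ (Set.range I.shiftedM)

theorem rowSpace_eq_map : I.rowSpace =
    (Submodule.span (SkewPolynomial F) (Set.range I.M)).map (shiftLinear I.γ) := by
  rw [Submodule.map_span, ← Set.range_comp]
  rfl

theorem mem_rowSpace {v : Fin (ℓ + 1) → SkewPolynomial F} :
    v ∈ I.rowSpace ↔ ∃ u, (∀ i, ModEq (I.g i) (u 0 * I.s i) (u i.succ)) ∧ shift I.γ u = v := by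
  rw [rowSpace_eq_map, Submodule.mem_map]
  exact exists_congr fun u => and_congr_left fun _ => I.mem_span_M

theorem shift_shiftDown {v : Fin (ℓ + 1) → SkewPolynomial F} (hv : v ∈ I.rowSpace) :
    shift I.γ (fun k => shiftDown (I.γ k) (v k)) = v := by
  obtain ⟨u, -, rfl⟩ := I.mem_rowSpace.1 hv
  funext k
  exact congrArg (· * X ^ I.γ k) (shiftDown_mul_X_pow (I.γ k) (u k))

/-- The rows of `W` form a basis of the row space of `Φ_γ(M)`. -/
def IsRowBasis (W : Fin (ℓ + 1) → Fin (ℓ + 1) → SkewPolynomial F) : Prop :=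
  LinearIndependent (SkewPolynomial F) W ∧
    Submodule.span (SkewPolynomial F) (Set.range W) = I.rowSpace

variable {I}

theorem IsRowBasis.mem {W : Fin (ℓ + 1) → Fin (ℓ + 1) → SkewPolynomial F} (hW : I.IsRowBasis W)
    (i : Fin (ℓ + 1)) : W i ∈ I.rowSpace :=
  hW.2 ▸ Submodule.subset_span ⟨i, rfl⟩

theorem IsRowBasis.exists_sum {W : Fin (ℓ + 1) → Fin (ℓ + 1) → SkewPolynomial F}
    (hW : I.IsRowBasis W) {v : Fin (ℓ + 1) → SkewPolynomial F} (hv : v ∈ I.rowSpace) :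
    ∃ a : Fin (ℓ + 1) → SkewPolynomial F, ∑ i, a i • W i = v := by
  rw [← hW.2] at hv
  exact (Submodule.mem_span_range_iff_exists_fun _).1 hv

theorem IsRowBasis.update {W : Fin (ℓ + 1) → Fin (ℓ + 1) → SkewPolynomial F}
    (hW : I.IsRowBasis W) {j : Fin (ℓ + 1)} {c : Fin (ℓ + 1) → SkewPolynomial F} (hc : c j = 0) :
    I.IsRowBasis (Function.update W j (W j + ∑ i, c i • W i)) :=
  ⟨linearIndependent_update_add hW.1 hc, (span_update_add W hc).trans hW.2⟩

theorem IsRowBasis.comp_equiv {W : Fin (ℓ + 1) → Fin (ℓ + 1) → SkewPolynomial F}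
    (hW : I.IsRowBasis W) (e : Fin (ℓ + 1) ≃ Fin (ℓ + 1)) : I.IsRowBasis (W ∘ e) :=
  ⟨hW.1.comp e e.injective, by rw [e.surjective.range_comp, hW.2]⟩

variable (I)

/-- `M` is triangular with the diagonal `1, g_1, …, g_ℓ`, and `Φ_γ` is injective. -/
theorem isRowBasis_shiftedM (hg : ∀ i, I.g i ≠ 0) : I.IsRowBasis I.shiftedM := by
  refine ⟨?_, rfl⟩
  have : I.shiftedM = shiftLinear I.γ ∘ I.M := rfl
  rw [this]
  refine LinearIndependent.map' ?_ _ (LinearMap.ker_eq_bot.2 (shiftLinear_injective I.γ))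
  rw [Fintype.linearIndependent_iff]
  intro a ha
  rw [Fin.sum_univ_succ] at ha
  have h0 : a 0 = 0 := by simpa using congrFun ha 0
  refine Fin.cases h0 fun i => ?_
  have h1 := congrFun ha i.succ
  simp only [h0, zero_smul, zero_add, Finset.sum_apply, Pi.smul_apply, smul_eq_mul, M_succ_succ,
    Pi.zero_apply] at h1
  rw [Finset.sum_eq_single_of_mem i (Finset.mem_univ i)
    (fun k _ hk => by rw [Pi.single_eq_of_ne hk.symm, mul_zero]), Pi.single_eq_same] at h1
  exact (mul_eq_zero.1 h1).resolve_right (hg i)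

/-- A basis of the row space with different leading positions is a reduction of `M`. -/
theorem IsRowBasis.isReduction {I : Problem F ℓ}
    {W V : Fin (ℓ + 1) → Fin (ℓ + 1) → SkewPolynomial F} (hW : I.IsRowBasis W)
    (hV : ∀ i, shift I.γ (V i) = W i) {d : Fin (ℓ + 1) → ℕ} {π : Fin (ℓ + 1) → Fin (ℓ + 1)}
    (hπ : Function.Injective π) (hd : ∀ i, HasLead (W i) (d i) (π i)) : I.IsReduction V := by
  refine ⟨?_, fun i j hij _ _ h => hij (hπ ?_)⟩
  · apply Submodule.map_injective_of_injective (shiftLinear_injective I.γ)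
    rw [← rowSpace_eq_map, ← hW.2, Submodule.map_span, ← Set.range_comp]
    congr 2
    exact funext hV
  · simp only [hV, leadPos_eq_iff.2 ⟨_, hd i⟩, leadPos_eq_iff.2 ⟨_, hd j⟩] at h
    exact WithBot.coe_inj.1 h

/-- In a basis with different leading positions the row with leading position `0` is a solution. -/
theorem IsRowBasis.isSolution {I : Problem F ℓ}
    {W : Fin (ℓ + 1) → Fin (ℓ + 1) → SkewPolynomial F} (hℓ : 0 < ℓ) (hW : I.IsRowBasis W)
    {d : Fin (ℓ + 1) → ℕ} {π : Fin (ℓ + 1) → Fin (ℓ + 1)} (hπ : Function.Injective π)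
    (hd : ∀ i, HasLead (W i) (d i) (π i)) {j : Fin (ℓ + 1)} (hj : π j = 0)
    {v : Fin (ℓ + 1) → SkewPolynomial F} (hv : shift I.γ v = W j) : I.IsSolution v := by
  -- Position `0` is leftmost and loses every tie, so leading there means exceeding all other
  -- degrees strictly; this is the degree constraint of the problem.
  have lead_iff : ∀ u : Fin (ℓ + 1) → SkewPolynomial F, ∀ n, HasLead (shift I.γ u) n 0 ↔
      u 0 ≠ 0 ∧ n = natDeg (u 0) + I.γ 0 ∧
        ∀ i : Fin ℓ, deg (u i.succ) + (I.γ i.succ : WithBot ℕ) <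
          deg (u 0) + (I.γ 0 : WithBot ℕ) := by
    intro u n
    constructor
    · intro h
      have h0 : u 0 ≠ 0 := by
        intro h0
        apply h.1
        simp [shift, h0]
      have hn : n = natDeg (u 0) + I.γ 0 := by
        rw [← h.natDeg_eq, shift, natDeg_mul_X_pow h0]
      refine ⟨h0, hn, fun i => ?_⟩
      by_cases hi : u i.succ = 0
      · rw [hi, deg_zero, WithBot.bot_add, deg_eq_natDeg h0]
        exact_mod_cast WithBot.bot_lt_coe _
      · have h1 : (shift I.γ u i.succ).coeff (natDeg (u i.succ) + I.γ i.succ) ≠ 0 := by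
          rw [shift, coeff_mul_X_pow, if_pos (by omega), Nat.add_sub_cancel]
          exact leadCoeff_ne_zero hi
        have h2 := (hasLead_iff.1 h).2 _ _ h1
        rw [deg_eq_natDeg hi, deg_eq_natDeg h0]
        have h3 : ¬ i.succ ≤ 0 := by simp
        have h4 : natDeg (u i.succ) + I.γ i.succ < natDeg (u 0) + I.γ 0 := by
          rw [← hn]
          tauto
        exact_mod_cast h4
    · rintro ⟨h0, rfl, h⟩
      rw [hasLead_iff]
      refine ⟨?_, fun k n hn => ?_⟩
      · rw [shift, coeff_mul_X_pow, if_pos (by omega), Nat.add_sub_cancel]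
        exact leadCoeff_ne_zero h0
      · rw [shift, coeff_mul_X_pow] at hn
        split_ifs at hn with hk
        · have h1 := le_natDeg hn
          revert hn h1 hk
          refine Fin.cases (fun hk hn h1 => ?_) (fun i hk hn h1 => ?_) k
          · have : (0 : Fin (ℓ + 1)) ≤ 0 := le_rfl
            omega
          · left
            have hi : u i.succ ≠ 0 := by
              intro hi
              rw [hi] at hn
              exact hn rfl
            have h2 := h i
            rw [deg_eq_natDeg hi, deg_eq_natDeg h0] at h2
            have h4 : natDeg (u i.succ) + I.γ i.succ < natDeg (u 0) + I.γ 0 := by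
              exact_mod_cast h2
            omega
        · exact absurd rfl hn
  have hlead : HasLead (shift I.γ v) (d j) 0 := hv ▸ hj ▸ hd j
  obtain ⟨hv0, hdj, hlt⟩ := (lead_iff v _).1 hlead
  have hvm : ∀ i, ModEq (I.g i) (v 0 * I.s i) (v i.succ) := by
    obtain ⟨u, hu, huv⟩ := I.mem_rowSpace.1 (hW.mem j)
    have : u = v := shiftLinear_injective I.γ (huv.trans hv.symm)
    exact this ▸ hu
  refine ⟨fun i => ⟨hvm i, hlt i⟩, fun u hu => ?_⟩
  have hu0 : u 0 ≠ 0 := by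
    intro h0
    have := (hu ⟨0, hℓ⟩).2
    rw [h0, deg_zero, WithBot.bot_add] at this
    exact not_lt_bot this
  have hul := (lead_iff u _).2 ⟨hu0, rfl, fun i => (hu i).2⟩
  obtain ⟨a, ha⟩ := hW.exists_sum (I.mem_rowSpace.2 ⟨u, fun i => (hu i).1, rfl⟩)
  have ha0 : a ≠ 0 := by
    rintro rfl
    refine hul.ne_zero ?_
    simpa using ha.symm
  -- The combination giving `u` inherits its leading position from one row. As `u` leads at `0`,
  -- this is row `j`, whose degree is therefore at most that of `u`.
  obtain ⟨k, hk, hkl, -⟩ := hasLead_sum_smul hπ hd ha0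
  rw [ha] at hkl
  obtain ⟨h1, h2⟩ := hul.unique hkl
  have : k = j := hπ (h2.symm.trans hj.symm)
  subst this
  rw [deg_eq_natDeg hv0, deg_eq_natDeg hu0]
  have h3 : natDeg (v 0) ≤ natDeg (u 0) := by omega
  exact_mod_cast h3

end Problem

/-! ### A lower bound for the degrees of a basis of the row space -/

section OfCoeffs

variable {F : Type u} [Field F]

/-- The skew polynomial with the given coefficients. -/
def ofCoeffs {n : ℕ} (f : Fin n → F) : SkewPolynomial F :=
  ∑ k : Fin n, monomial (k : ℕ) (f k)

theorem coeff_ofCoeffs {n : ℕ} (f : Fin n → F) (k : ℕ) :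
    (ofCoeffs f).coeff k = if h : k < n then f ⟨k, h⟩ else 0 := by
  rw [ofCoeffs, coeff_finset_sum]
  simp only [coeff_monomial]
  split_ifs with h
  · rw [Finset.sum_eq_single_of_mem ⟨k, h⟩ (Finset.mem_univ _)]
    · simp
    · intro i _ hi
      exact if_neg fun h' => hi (Fin.ext h')
  · exact Finset.sum_eq_zero fun i _ => if_neg (by omega)

theorem lt_of_coeff_ofCoeffs_ne_zero {n : ℕ} {f : Fin n → F} {k : ℕ}
    (h : (ofCoeffs f).coeff k ≠ 0) : k < n := by
  by_contra hk
  exact h (by rw [coeff_ofCoeffs, dif_neg hk])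

theorem ofCoeffs_injective (n : ℕ) : Function.Injective (ofCoeffs (F := F) (n := n)) :=
  fun f f' h => by
    funext k
    have := congrArg (fun p => p.coeff k) h
    simpa [coeff_ofCoeffs] using this

end OfCoeffs

namespace Problem

variable {F : Type u} [Field F] [MulSemiringAction (Multiplicative ℕ) F] {ℓ : ℕ} {I : Problem F ℓ}

/-- A count of vectors with degrees at most `D`, for a large `D`. The multiples of the rows `W j` by
skew polynomials of degree at most `D - d j`, together with a remainder modulo each `g_i`, give
pairwise different vectors whose entry `k` is `x^{γ_k}`-divisible of degree at most `D`. Comparing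
the exponents of the cardinality of `F` gives the inequality. -/
theorem IsRowBasis.sum_le [Finite F]
    {W : Fin (ℓ + 1) → Fin (ℓ + 1) → SkewPolynomial F} (hW : I.IsRowBasis W)
    {d : Fin (ℓ + 1) → ℕ} (hd : ∀ j k n, (W j k).coeff n ≠ 0 → n ≤ d j) :
    ∑ k, I.γ k + ∑ i, natDeg (I.g i) ≤ ∑ j, d j := by
  classical
  have := Fintype.ofFinite F
  -- Large enough to exceed every `d j`, `γ k` and `γ i.succ + natDeg (g i)`, so that none of the
  -- subtractions below is truncated.
  let D : ℕ := ∑ j, d j + ∑ k, I.γ k + ∑ i, natDeg (I.g i)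
  have hdD : ∀ j, d j ≤ D := fun j => by
    have := Finset.single_le_sum (f := d) (fun _ _ => Nat.zero_le _) (Finset.mem_univ j)
    simp only [D]
    omega
  have hγD : ∀ k, I.γ k ≤ D := fun k => by
    have := Finset.single_le_sum (f := I.γ) (fun _ _ => Nat.zero_le _) (Finset.mem_univ k)
    simp only [D]
    omega
  have hgD : ∀ i : Fin ℓ, I.γ i.succ + natDeg (I.g i) ≤ D := fun i => by
    have h1 := Finset.single_le_sum (f := I.γ) (fun _ _ => Nat.zero_le _) (Finset.mem_univ i.succ)
    have h2 := Finset.single_le_sum (f := fun i => natDeg (I.g i)) (fun _ _ => Nat.zero_le _)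
      (Finset.mem_univ i)
    simp only [D] at h1 h2 ⊢
    omega
  let rest : (∀ i : Fin ℓ, Fin (natDeg (I.g i)) → F) → Fin (ℓ + 1) → SkewPolynomial F :=
    fun r => Fin.cons 0 fun i => ofCoeffs (r i) * X ^ I.γ i.succ
  let vec : (∀ j, Fin (D + 1 - d j) → F) × (∀ i : Fin ℓ, Fin (natDeg (I.g i)) → F) →
      Fin (ℓ + 1) → SkewPolynomial F :=
    fun x => ∑ j, ofCoeffs (x.1 j) • W j + rest x.2
  have hsum : ∀ a : ∀ j, Fin (D + 1 - d j) → F, ∑ j, ofCoeffs (a j) • W j ∈ I.rowSpace :=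
    fun a => Submodule.sum_mem _ fun j _ => Submodule.smul_mem _ _ (hW.mem j)
  have hcoeff : ∀ x k n, (vec x k).coeff n ≠ 0 → I.γ k ≤ n ∧ n ≤ D := by
    intro x k n hn
    have hn' : ((∑ j, ofCoeffs (x.1 j) • W j) k).coeff n ≠ 0 ∨ (rest x.2 k).coeff n ≠ 0 := by
      by_contra! h
      apply hn
      simp only [vec, Pi.add_apply, coeff_add]
      rw [h.1, h.2, add_zero]
    rcases hn' with h | h
    · constructor
      · obtain ⟨u, -, hu⟩ := I.mem_rowSpace.1 (hsum x.1)
        rw [← hu, shift, coeff_mul_X_pow] at h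
        by_contra h'
        exact h (if_neg h')
      · rw [Finset.sum_apply, coeff_finset_sum] at h
        obtain ⟨j, -, hj⟩ := Finset.exists_ne_zero_of_sum_ne_zero h
        obtain ⟨p, q, rfl, hp, hq⟩ := coeff_mul_ne_zero hj
        have h1 := lt_of_coeff_ofCoeffs_ne_zero hp
        have h2 := hd j k q hq
        omega
    · revert h
      refine Fin.cases (fun h => absurd rfl h) (fun i h => ?_) k
      simp only [rest, Fin.cons_succ, coeff_mul_X_pow] at h
      split_ifs at h with h1
      · have h2 := lt_of_coeff_ofCoeffs_ne_zero h
        have h3 := hgD i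
        omega
      · exact absurd rfl h
  -- If two vectors agree, the difference of the remainders lies in the row space with zeroth entry
  -- `0`, so it is a multiple of each `g_i` and vanishes by degree. Linear independence of the rows
  -- settles the rest.
  have hinj : Function.Injective vec := by
    intro x y hxy
    have hrow : rest y.2 - rest x.2 ∈ I.rowSpace := by
      have : rest y.2 - rest x.2 =
          ∑ j, ofCoeffs (x.1 j) • W j - ∑ j, ofCoeffs (y.1 j) • W j := by
        have h3 : vec y = vec x := hxy.symm
        rw [sub_eq_sub_iff_add_eq_add, add_comm (rest y.2)]
        exact h3
      rw [this]
      exact Submodule.sub_mem _ (hsum _) (hsum _)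
    obtain ⟨u, hu, huv⟩ := I.mem_rowSpace.1 hrow
    have hu0 : u 0 = 0 := by
      have h0 := congrFun huv 0
      apply mul_X_pow_injective (I.γ 0)
      rw [zero_mul]
      exact h0.trans (by simp [rest])
    have h2 : x.2 = y.2 := by
      funext i
      apply ofCoeffs_injective
      have hui : u i.succ = ofCoeffs (y.2 i) - ofCoeffs (x.2 i) := by
        apply mul_X_pow_injective (I.γ i.succ)
        rw [sub_mul]
        exact congrFun huv i.succ
      obtain ⟨e, he⟩ := hu i
      rw [hu0, zero_mul, hui] at he
      refine ModEq.eq_of_lt (g := I.g i) (p := ofCoeffs (x.2 i)) ⟨0, by simp⟩ ⟨e, ?_⟩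
        (fun n => lt_of_coeff_ofCoeffs_ne_zero) (fun n => lt_of_coeff_ofCoeffs_ne_zero)
      rw [← add_zero (ofCoeffs (x.2 i)), he]
      abel
    have h1 : ∑ j, (ofCoeffs (x.1 j) - ofCoeffs (y.1 j)) • W j = 0 := by
      have h3 : vec x = vec y := hxy
      simp only [vec, h2, add_left_inj] at h3
      simp only [sub_smul, Finset.sum_sub_distrib, h3, sub_self]
    have h4 := Fintype.linearIndependent_iff.1 hW.1 _ h1
    refine Prod.ext (funext fun j => ofCoeffs_injective _ (sub_eq_zero.1 (h4 j))) h2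
  -- Entry `k` is determined by its coefficients at the exponents `γ k, …, D`.
  let f : (∀ j, Fin (D + 1 - d j) → F) × (∀ i : Fin ℓ, Fin (natDeg (I.g i)) → F) →
      ∀ k, Fin (D + 1 - I.γ k) → F := fun x k n => (vec x k).coeff (n + I.γ k)
  have hf : Function.Injective f := by
    intro x y hxy
    apply hinj
    funext k
    ext n
    by_cases hn : I.γ k ≤ n ∧ n ≤ D
    · have := congrFun (congrFun hxy k) ⟨n - I.γ k, by omega⟩
      simpa only [f, Nat.sub_add_cancel hn.1] using this
    · rw [not_imp_comm.1 (hcoeff x k n) hn, not_imp_comm.1 (hcoeff y k n) hn]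
  have hcard := Fintype.card_le_of_injective f hf
  simp only [Fintype.card_prod, Fintype.card_pi, Finset.prod_const, Finset.card_univ,
    Fintype.card_fin, Finset.prod_pow_eq_pow_sum, ← pow_add] at hcard
  -- Both sides are powers of the cardinality of `F`, which is at least two.
  have hexp := (Nat.pow_le_pow_iff_right Fintype.one_lt_card).1 hcard
  have e1 : ∑ j, (D + 1 - d j) + ∑ j, d j = (ℓ + 1) * (D + 1) := by
    rw [← Finset.sum_add_distrib]
    simp only [fun j => Nat.sub_add_cancel ((hdD j).trans (Nat.le_succ D)), Nat.succ_eq_add_one]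
    simp
  have e2 : ∑ k, (D + 1 - I.γ k) + ∑ k, I.γ k = (ℓ + 1) * (D + 1) := by
    rw [← Finset.sum_add_distrib]
    simp only [fun k => Nat.sub_add_cancel ((hγD k).trans (Nat.le_succ D)), Nat.succ_eq_add_one]
    simp
  omega

end Problem

/-! ### Cancelling leading monomials -/

section Cancel

variable {F : Type u} [Field F] {m : ℕ}

theorem natDeg_monomial_le (β : ℕ) (α : F) : natDeg (monomial β α) ≤ β :=
  natDeg_le fun n hn => by
    rw [coeff_monomial] at hn
    by_contra h
    exact hn (if_neg (by omega))

/-- One more than the number of the leading monomial, and `0` for the zero vector. -/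
def weight (v : Fin m → SkewPolynomial F) : ℕ :=
  Finset.univ.sup fun k : Fin m => (v k).support.sup fun n => m * n + k + 1

theorem weight_le_iff {v : Fin m → SkewPolynomial F} {b : ℕ} :
    weight v ≤ b ↔ Below (b : ℤ) v := by
  simp only [weight, Finset.sup_le_iff, Finset.mem_univ, true_imp_iff, mem_support_iff, Below, key]
  refine forall_congr' fun k => forall_congr' fun n => imp_congr_right fun _ => ?_
  rw [Nat.succ_le_iff]
  exact_mod_cast Iff.rfl

theorem HasLead.weight_eq {v : Fin m → SkewPolynomial F} {n : ℕ} {k : Fin m}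
    (h : HasLead v n k) : weight v = m * n + k + 1 := by
  apply le_antisymm
  · rw [weight_le_iff]
    refine h.2.mono (le_of_eq ?_)
    simp [key]
  · have := (weight_le_iff.1 le_rfl).lt_of_hasLead h
    rw [key] at this
    exact_mod_cast this

variable [MulSemiringAction (Multiplicative ℕ) F]

/-- Multiplying `w` by `x^(n - n')` twists its leading coefficient by `θ^(n - n')`. Dividing by the
twisted coefficient makes the top monomials agree, so they cancel. -/
theorem below_sub_monomial_smul {v w : Fin m → SkewPolynomial F} {n n' : ℕ} {k : Fin m}
    (hv : Below (key n k + 1) v) (hw : HasLead w n' k) (hn : n' ≤ n) :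
    Below (key n k)
      (v - monomial (n - n') ((v k).coeff n / φ^[n - n'] ((w k).coeff n')) • w) := by
  have hk : key n k = m * (n - n' : ℕ) + key n' k := by
    rw [← key_add, Nat.sub_add_cancel hn]
  refine Below.of_coeff_eq_zero (hv.sub ?_) ?_
  · rw [hk, add_assoc]
    exact hw.2.smul (natDeg_monomial_le _ _)
  · rw [Pi.sub_apply, Pi.smul_apply, smul_eq_mul, coeff_sub, coeff_monomial_mul,
      if_pos (Nat.sub_le n n'), Nat.sub_sub_self hn,
      div_mul_cancel₀ _ (mt (phi_iterate_eq_zero _).1 hw.1), sub_self]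

end Cancel

namespace Problem

theorem le_μ {F : Type u} [Field F] {ℓ : ℕ} (I : Problem F ℓ) (i : Fin ℓ) : I.γ i.succ + natDeg (I.g i) ≤ I.μ :=
  Finset.le_sup (f := fun i : Fin ℓ => I.γ i.succ + natDeg (I.g i)) (Finset.mem_univ i)

variable {F : Type u} [Field F] [MulSemiringAction (Multiplicative ℕ) F] {ℓ : ℕ} (I : Problem F ℓ)

/-! ### The matrix `Φ_γ(M)` -/

theorem shiftedM_succ_succ (i k : Fin ℓ) : I.shiftedM i.succ k.succ =
    (Pi.single i (I.g i) : Fin ℓ → SkewPolynomial F) k * X ^ I.γ k.succ := rfl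

theorem shiftedM_zero_zero : I.shiftedM 0 0 = X ^ I.γ 0 := one_mul _

theorem shiftedM_succ_zero (i : Fin ℓ) : I.shiftedM i.succ 0 = 0 := zero_mul _

theorem eq_of_coeff_shiftedM_zero {j : Fin (ℓ + 1)} {n : ℕ} (h : (I.shiftedM j 0).coeff n ≠ 0) :
    n = I.γ 0 := by
  revert h
  refine Fin.cases (fun h => ?_) (fun i h => ?_) j
  · rw [shiftedM_zero_zero, ← monomial_one_right_eq_X_pow, coeff_monomial] at h
    by_contra h'
    exact h (if_neg (by omega))
  · rw [shiftedM_succ_zero] at h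
    exact absurd rfl h

theorem le_of_coeff_shiftedM_succ (hs : ∀ i, deg (I.s i) ≤ deg (I.g i)) {j : Fin (ℓ + 1)}
    {i : Fin ℓ} {n : ℕ} (h : (I.shiftedM j i.succ).coeff n ≠ 0) :
    n ≤ I.γ i.succ + natDeg (I.g i) := by
  have key : ∀ p : SkewPolynomial F, natDeg p ≤ natDeg (I.g i) →
      (p * X ^ I.γ i.succ).coeff n ≠ 0 → n ≤ I.γ i.succ + natDeg (I.g i) := by
    intro p hp hn
    rw [coeff_mul_X_pow] at hn
    split_ifs at hn with h1
    · have := le_natDeg hn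
      omega
    · exact absurd rfl hn
  revert h
  refine Fin.cases (fun h => ?_) (fun k h => ?_) j
  · exact key _ (natDeg_le_of_deg_le (hs i)) h
  · refine key _ ?_ h
    by_cases hik : i = k
    · subst hik
      simp
    · simp [hik]

theorem le_of_coeff_shiftedM (hs : ∀ i, deg (I.s i) ≤ deg (I.g i)) {j k : Fin (ℓ + 1)} {n : ℕ}
    (h : (I.shiftedM j k).coeff n ≠ 0) : n ≤ max (I.γ 0) I.μ := by
  revert h
  refine Fin.cases (fun h => ?_) (fun i h => ?_) k
  · exact le_max_of_le_left (I.eq_of_coeff_shiftedM_zero h).le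
  · exact le_max_of_le_right ((I.le_of_coeff_shiftedM_succ hs h).trans (I.le_μ i))

theorem hasLead_shiftedM_succ (hg : ∀ i, I.g i ≠ 0) (i : Fin ℓ) :
    HasLead (I.shiftedM i.succ) (I.γ i.succ + natDeg (I.g i)) i.succ := by
  rw [hasLead_iff]
  constructor
  · rw [shiftedM_succ_succ, Pi.single_eq_same, coeff_mul_X_pow, if_pos (by omega),
      Nat.add_sub_cancel_left]
    exact leadCoeff_ne_zero (hg i)
  · intro k n
    refine Fin.cases (fun hn => ?_) (fun k hn => ?_) k
    · rw [shiftedM_succ_zero] at hn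
      exact absurd rfl hn
    · rw [shiftedM_succ_succ] at hn
      by_cases hk : k = i
      · subst hk
        rw [Pi.single_eq_same, coeff_mul_X_pow] at hn
        split_ifs at hn with h
        · have := le_natDeg hn
          have h2 : k.succ ≤ k.succ := le_rfl
          omega
        · exact absurd rfl hn
      · rw [Pi.single_eq_of_ne hk, zero_mul] at hn
        exact absurd rfl hn

theorem weight_shiftedM_zero_le (hs : ∀ i, deg (I.s i) ≤ deg (I.g i)) :
    weight (I.shiftedM 0) ≤ max ((ℓ + 1) * I.γ 0 + 1) ((ℓ + 1) * I.μ + ℓ + 1) := by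
  rw [weight_le_iff]
  intro k n
  refine Fin.cases (fun hn => ?_) (fun i hn => ?_) k
  · rw [I.eq_of_coeff_shiftedM_zero hn]
    simp [key]
  · have h1 := (I.le_of_coeff_shiftedM_succ hs hn).trans (I.le_μ i)
    have h2 : (ℓ + 1) * n ≤ (ℓ + 1) * I.μ := Nat.mul_le_mul_left _ h1
    have h3 := i.isLt
    have h4 : (ℓ + 1) * n + (i + 1) < (ℓ + 1) * I.μ + ℓ + 1 := by omega
    rw [key, Fin.val_succ, Nat.cast_max]
    refine lt_max_of_lt_right ?_
    exact_mod_cast h4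

end Problem

/-! ### The Mulders–Storjohann algorithm -/

section MuldersStorjohann

variable {F : Type u} [Field F] [MulSemiringAction (Multiplicative ℕ) F] {m : ℕ}

theorem simpleTransformation_val {V : Fin m → Fin m → SkewPolynomial F} {i j h : Fin m}
    {ni nj : ℕ} (hi : HasLead (V i) ni h) (hj : HasLead (V j) nj h) :
    (simpleTransformation i j h V).val = Function.update V j
      (V j - monomial (nj - ni) ((V j h).coeff nj / φ^[nj - ni] ((V i h).coeff ni)) • V i) := by
  simp only [simpleTransformation, Cost.val_bind, Cost.val_pure, Cost.val_pi, subMulShift_val,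
    val_frob, val_div, leadCoeff, hi.natDeg_eq, hj.natDeg_eq]
  rfl

theorem simpleTransformation_ops_le {V : Fin m → Fin m → SkewPolynomial F} {D : ℕ}
    (hV : ∀ i k n, (V i k).coeff n ≠ 0 → n ≤ D) (i j h : Fin m) :
    (simpleTransformation i j h V).ops ≤ 2 + m * (3 * (D + 1)) := by
  simp only [simpleTransformation, Cost.ops_bind, Cost.ops_pure, Cost.ops_pi, ops_frob, ops_div]
  have : ∀ α β, ∑ k, (subMulShift α β (V j k) (V i k)).ops ≤ m * (3 * (D + 1)) := by
    intro α β
    refine (Finset.sum_le_card_nsmul _ _ (3 * (D + 1)) fun k _ => ?_).trans (by simp)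
    refine (subMulShift_ops _ _ _ _).trans ?_
    have := natDeg_le (hV i k)
    omega
  have := this ((div (leadCoeff (V j h)) (frob (natDeg (V j h) - natDeg (V i h))
    (leadCoeff (V i h))).val).val) (natDeg (V j h) - natDeg (V i h))
  omega

theorem msStep_iff {V : Fin m → Fin m → SkewPolynomial F}
    {c : Cost (Fin m → Fin m → SkewPolynomial F)} :
    MSStep V c ↔ ∃ i j h ni nj, i ≠ j ∧ HasLead (V i) ni h ∧ HasLead (V j) nj h ∧ ni ≤ nj ∧
      c = simpleTransformation i j h V := by
  constructor
  · rintro ⟨i, j, h, hij, hi, hj, hd, hc⟩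
    obtain ⟨ni, hi⟩ := leadPos_eq_iff.1 hi
    obtain ⟨nj, hj⟩ := leadPos_eq_iff.1 hj
    refine ⟨i, j, h, ni, nj, hij, hi, hj, ?_, hc⟩
    have := natDeg_le_of_deg_le hd
    rwa [hi.natDeg_eq, hj.natDeg_eq] at this
  · rintro ⟨i, j, h, ni, nj, hij, hi, hj, hd, hc⟩
    refine ⟨i, j, h, hij, leadPos_eq_iff.2 ⟨_, hi⟩, leadPos_eq_iff.2 ⟨_, hj⟩, ?_, hc⟩
    rw [deg_eq_natDeg (fun h0 => hi.1 (by rw [h0]; rfl)),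
      deg_eq_natDeg (fun h0 => hj.1 (by rw [h0]; rfl)), hi.natDeg_eq, hj.natDeg_eq]
    exact_mod_cast hd

/-- When no step is possible, the leading positions of non-zero rows are different. -/
theorem exists_hasLead_of_not_msStep {V : Fin m → Fin m → SkewPolynomial F}
    (h : ∀ c, ¬ MSStep V c) (hV : ∀ i, V i ≠ 0) :
    ∃ (d : Fin m → ℕ) (π : Fin m → Fin m), Function.Injective π ∧
      ∀ i, HasLead (V i) (d i) (π i) := by
  choose d π hd using fun i => exists_hasLead (hV i)
  refine ⟨d, π, fun i j hij => ?_, hd⟩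
  by_contra hne
  rcases le_total (d i) (d j) with hle | hle
  · exact h _ (msStep_iff.2 ⟨i, j, π j, d i, d j, hne, hij ▸ hd i, hd j, hle, rfl⟩)
  · exact h _ (msStep_iff.2 ⟨j, i, π i, d j, d i, Ne.symm hne, hij ▸ hd j, hd i, hle, rfl⟩)

end MuldersStorjohann

/-! ### Mulders–Storjohann on `Φ_γ(M)`: invariant, correctness, number of operations -/

namespace Problem

variable {F : Type u} [Field F] [MulSemiringAction (Multiplicative ℕ) F] {ℓ : ℕ} {I : Problem F ℓ}

/-- The invariant of the row reduction: the rows form a basis of the row space, and their degrees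
are at most `D`. -/
def MSInvariant (I : Problem F ℓ) (D : ℕ)
    (V : Fin (ℓ + 1) → Fin (ℓ + 1) → SkewPolynomial F) : Prop :=
  I.IsRowBasis V ∧ ∀ i k n, (V i k).coeff n ≠ 0 → n ≤ D

/-- The leading monomial of row `j` is cancelled and everything new lies below it, so the weight of
row `j` drops, the other rows stay, and no degree grows. The cost is `2` for the factor and at most
`3 (D + 1)` for each of the `ℓ + 1` entries. -/
theorem MSInvariant.step {D : ℕ} {V : Fin (ℓ + 1) → Fin (ℓ + 1) → SkewPolynomial F}
    {c : Cost (Fin (ℓ + 1) → Fin (ℓ + 1) → SkewPolynomial F)} (hV : I.MSInvariant D V)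
    (hc : MSStep V c) : I.MSInvariant D c.val ∧
      ∑ i, weight (c.val i) < ∑ i, weight (V i) ∧ c.ops ≤ 2 + (ℓ + 1) * (3 * (D + 1)) := by
  obtain ⟨i, j, h, ni, nj, hij, hi, hj, hn, rfl⟩ := msStep_iff.1 hc
  have hb := below_sub_monomial_smul hj.2 hi hn
  rw [simpleTransformation_val hi hj]
  set α := monomial (nj - ni) ((V j h).coeff nj / φ^[nj - ni] ((V i h).coeff ni))
  refine ⟨⟨?_, ?_⟩, ?_, simpleTransformation_ops_le hV.2 i j h⟩
  · have := hV.1.update (j := j) (c := Pi.single i (-α)) (Pi.single_eq_of_ne hij.symm _)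
    rw [Finset.sum_eq_single_of_mem i (Finset.mem_univ i)
      (fun k _ hk => by rw [Pi.single_eq_of_ne hk, zero_smul]), Pi.single_eq_same, neg_smul,
      ← sub_eq_add_neg] at this
    exact this
  · intro k p n hkn
    by_cases hk : k = j
    · subst hk
      rw [Function.update_self] at hkn
      have h1 := hb p n hkn
      have h2 := hV.2 k h nj hj.1
      rw [key_lt_key] at h1
      omega
    · rw [Function.update_of_ne hk] at hkn
      exact hV.2 k p n hkn
  · refine Finset.sum_lt_sum (fun k _ => ?_) ⟨j, Finset.mem_univ j, ?_⟩
    · by_cases hk : k = j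
      · subst hk
        rw [Function.update_self, hj.weight_eq, weight_le_iff]
        refine hb.mono ?_
        simp only [key]
        push_cast
        omega
      · rw [Function.update_of_ne hk]
    · rw [Function.update_self, hj.weight_eq, Nat.lt_succ_iff, weight_le_iff]
      refine hb.mono (le_of_eq ?_)
      simp [key]

theorem msInvariant_shiftedM (hg : ∀ i, I.g i ≠ 0) (hs : ∀ i, deg (I.s i) ≤ deg (I.g i)) :
    I.MSInvariant (max (I.γ 0) I.μ) I.shiftedM :=
  ⟨I.isRowBasis_shiftedM hg, fun _ _ _ h => I.le_of_coeff_shiftedM hs h⟩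

theorem terminates_ms (hg : ∀ i, I.g i ≠ 0) (hs : ∀ i, deg (I.s i) ≤ deg (I.g i)) :
    Terminates MSStep I.shiftedM :=
  terminates_of_potential (pot := fun V => ∑ i, weight (V i))
    (fun _ _ h hc => ⟨(h.step hc).1, (h.step hc).2.1⟩) (msInvariant_shiftedM hg hs)

theorem exists_hasLead_of_loop (hg : ∀ i, I.g i ≠ 0) (hs : ∀ i, deg (I.s i) ≤ deg (I.g i))
    {W : Cost (Fin (ℓ + 1) → Fin (ℓ + 1) → SkewPolynomial F)} (hW : Loop MSStep I.shiftedM W) :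
    I.IsRowBasis W.val ∧ ∃ (d : Fin (ℓ + 1) → ℕ) (π : Fin (ℓ + 1) → Fin (ℓ + 1)),
      Function.Injective π ∧ ∀ i, HasLead (W.val i) (d i) (π i) := by
  have hb := (hW.invariant (fun _ _ h hc => (MSInvariant.step h hc).1)
    (msInvariant_shiftedM hg hs)).1
  exact ⟨hb, exists_hasLead_of_not_msStep hW.not_step fun i => hb.1.ne_zero i⟩

theorem exists_msRun (hg : ∀ i, I.g i ≠ 0) (hs : ∀ i, deg (I.s i) ≤ deg (I.g i)) :
    ∃ c, I.MSRun c := by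
  obtain ⟨W, hW⟩ := (terminates_ms hg hs).exists_loop
  obtain ⟨hb, d, π, hπ, hd⟩ := exists_hasLead_of_loop hg hs hW
  obtain ⟨i, hi⟩ := (Finite.injective_iff_surjective.1 hπ) 0
  refine ⟨⟨(fun i k => shiftDown (I.γ k) (W.val i k), fun k => shiftDown (I.γ k) (W.val i k)),
    W.ops⟩, W, hW, rfl, ⟨i, rfl, ?_⟩, rfl⟩
  refine leadPos_eq_iff.2 ⟨d i, ?_⟩
  simp only
  rw [I.shift_shiftDown (hb.mem i), ← hi]
  exact hd i

theorem msRun_correct (hℓ : 0 < ℓ) (hg : ∀ i, I.g i ≠ 0)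
    (hs : ∀ i, deg (I.s i) ≤ deg (I.g i))
    {c : Cost ((Fin (ℓ + 1) → Fin (ℓ + 1) → SkewPolynomial F) ×
      (Fin (ℓ + 1) → SkewPolynomial F))} (hc : I.MSRun c) :
    I.IsReduction c.val.1 ∧ I.IsSolution c.val.2 := by
  obtain ⟨W, hW, h1, ⟨i, h2, h3⟩, -⟩ := hc
  obtain ⟨hb, d, π, hπ, hd⟩ := exists_hasLead_of_loop hg hs hW
  have hV : ∀ j, shift I.γ (c.val.1 j) = W.val j := fun j => by
    rw [h1]
    exact I.shift_shiftDown (hb.mem j)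
  refine ⟨hb.isReduction hV hπ hd, hb.isSolution hℓ hπ hd (j := i) ?_ (h2 ▸ hV i)⟩
  rw [hV, leadPos_eq_iff.2 ⟨_, hd i⟩] at h3
  exact WithBot.coe_inj.1 h3

/-- The number of steps is at most the number of monomials between the first row of `Φ_γ(M)` and
`x^{γ_0}` in position `0`. -/
theorem loop_ms_ops_le [Finite F] (hg : ∀ i, I.g i ≠ 0) (hs : ∀ i, deg (I.s i) ≤ deg (I.g i))
    {W : Cost (Fin (ℓ + 1) → Fin (ℓ + 1) → SkewPolynomial F)} (hW : Loop MSStep I.shiftedM W) :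
    W.ops ≤ (2 + (ℓ + 1) * (3 * (max (I.γ 0) I.μ + 1))) *
      (weight (I.shiftedM 0) - ((ℓ + 1) * I.γ 0 + 1)) := by
  obtain ⟨hb, d, π, hπ, hd⟩ := exists_hasLead_of_loop hg hs hW
  have hops := hW.ops_le (pot := fun V => ∑ i, weight (V i))
    (fun _ _ h hc => MSInvariant.step h hc) (msInvariant_shiftedM hg hs)
  -- At the end `π` is a permutation, so the positions contribute the same sum as in any other
  -- arrangement.
  have hfin : ∑ i, weight (W.val i) = (ℓ + 1) * ∑ i, d i + ∑ k : Fin (ℓ + 1), ((k : ℕ) + 1) := by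
    rw [← (Equiv.ofBijective π (Finite.injective_iff_bijective.1 hπ)).sum_comp
      (fun k => (k : ℕ) + 1), Finset.mul_sum, ← Finset.sum_add_distrib]
    refine Finset.sum_congr rfl fun i _ => ?_
    rw [(hd i).weight_eq, Equiv.ofBijective_apply, add_assoc]
  have hini : ∑ i, weight (I.shiftedM i) = weight (I.shiftedM 0) +
      ((ℓ + 1) * ∑ i : Fin ℓ, (I.γ i.succ + natDeg (I.g i)) +
        ∑ i : Fin ℓ, ((i.succ : ℕ) + 1)) := by
    rw [Fin.sum_univ_succ, Finset.mul_sum, ← Finset.sum_add_distrib]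
    congr 1
    refine Finset.sum_congr rfl fun i _ => ?_
    rw [(I.hasLead_shiftedM_succ hg i).weight_eq, add_assoc]
  -- Bounds the final degrees from below by `∑ γ + ∑ deg g`; the rows `1, …, ℓ` of `Φ_γ(M)` account
  -- for all of this except `γ 0`.
  have hcount := hb.sum_le fun j k n hn => (hd j).le hn
  have hmul := Nat.mul_le_mul_left (ℓ + 1) hcount
  rw [Fin.sum_univ_succ (fun k => I.γ k), add_assoc, ← Finset.sum_add_distrib, Nat.mul_add] at hmul
  rw [Fin.sum_univ_succ (fun k : Fin (ℓ + 1) => (k : ℕ) + 1), Fin.val_zero] at hfin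
  have hpot : ∑ i, weight (I.shiftedM i) ≤
      ∑ i, weight (W.val i) + (weight (I.shiftedM 0) - ((ℓ + 1) * I.γ 0 + 1)) := by
    omega
  generalize 2 + (ℓ + 1) * (3 * (max (I.γ 0) I.μ + 1)) = C at hops ⊢
  have := Nat.mul_le_mul_left C hpot
  rw [Nat.mul_add] at this
  omega

theorem msRun_ops_le [Finite F] (hℓ : 0 < ℓ) (hg : ∀ i, I.g i ≠ 0)
    (hs : ∀ i, deg (I.s i) ≤ deg (I.g i)) (hμ : 1 ≤ I.μ)
    {c : Cost ((Fin (ℓ + 1) → Fin (ℓ + 1) → SkewPolynomial F) ×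
      (Fin (ℓ + 1) → SkewPolynomial F))} (hc : I.MSRun c) :
    c.ops ≤ 42 * (ℓ ^ 2 * I.μ ^ 2) := by
  obtain ⟨W, hW, -, -, hcW⟩ := hc
  rw [hcW]
  have h1 := loop_ms_ops_le hg hs hW
  have h2 := I.weight_shiftedM_zero_le hs
  rcases le_or_gt (I.γ 0) I.μ with hγ | hγ
  · rw [max_eq_right hγ] at h1
    have h3 : (ℓ + 1) * I.γ 0 ≤ (ℓ + 1) * I.μ := Nat.mul_le_mul_left _ hγ
    rw [max_eq_right (by omega)] at h2
    have hℓμ : 1 ≤ ℓ * I.μ := Nat.mul_pos hℓ hμ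
    have hℓ' : ℓ ≤ ℓ * I.μ := Nat.le_mul_of_pos_right _ hμ
    have hμ' : I.μ ≤ ℓ * I.μ := Nat.le_mul_of_pos_left _ hℓ
    have h4 : weight (I.shiftedM 0) - ((ℓ + 1) * I.γ 0 + 1) ≤ 3 * (ℓ * I.μ) := by
      have : (ℓ + 1) * I.μ = ℓ * I.μ + I.μ := by ring
      omega
    have h5 : 2 + (ℓ + 1) * (3 * (I.μ + 1)) ≤ 14 * (ℓ * I.μ) := by
      have : (ℓ + 1) * (3 * (I.μ + 1)) = 3 * (ℓ * I.μ) + 3 * ℓ + 3 * I.μ + 3 := by ring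
      omega
    calc W.ops ≤ _ := h1
      _ ≤ 14 * (ℓ * I.μ) * (3 * (ℓ * I.μ)) := Nat.mul_le_mul h5 h4
      _ = 42 * (ℓ ^ 2 * I.μ ^ 2) := by ring
  -- For `γ 0 > μ` row `0` already leads at position `0`, so the potential cannot drop and the loop
  -- costs nothing.
  · have h3 : (ℓ + 1) * (I.μ + 1) ≤ (ℓ + 1) * I.γ 0 := Nat.mul_le_mul_left _ hγ
    have h4 : (ℓ + 1) * (I.μ + 1) = (ℓ + 1) * I.μ + ℓ + 1 := by ring
    have h5 : weight (I.shiftedM 0) - ((ℓ + 1) * I.γ 0 + 1) = 0 := by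
      rw [max_eq_left (by omega)] at h2
      omega
    rw [h5, mul_zero] at h1
    omega

end Problem

/-! ### The rows behind the demand-driven algorithm -/

section Tail

variable {F : Type u} [Field F] [MulSemiringAction (Multiplicative ℕ) F] {ℓ : ℕ}

/-- Removes the entry in position `0`. -/
def tail : (Fin (ℓ + 1) → SkewPolynomial F) →ₗ[SkewPolynomial F] (Fin ℓ → SkewPolynomial F) :=
  LinearMap.funLeft _ _ Fin.succ

@[simp] theorem tail_apply (v : Fin (ℓ + 1) → SkewPolynomial F) (i : Fin ℓ) :
    tail v i = v i.succ := rfl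

theorem HasLead.tail {v : Fin (ℓ + 1) → SkewPolynomial F} {n : ℕ} {i : Fin ℓ}
    (h : HasLead v n i.succ) : HasLead (tail v) n i := by
  rw [hasLead_iff] at h ⊢
  exact ⟨h.1, fun k n' hn' => by simpa using h.2 k.succ n' hn'⟩

/-- Position `0` loses ties, so an entry of the same degree there does not move the leading
position. -/
theorem HasLead.of_tail {v : Fin (ℓ + 1) → SkewPolynomial F} {n : ℕ} {i : Fin ℓ}
    (h : HasLead (SkewShiftRegister.tail v) n i) (h0 : ∀ n', (v 0).coeff n' ≠ 0 → n' ≤ n) :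
    HasLead v n i.succ := by
  rw [hasLead_iff] at h ⊢
  refine ⟨h.1, fun k n' => ?_⟩
  refine Fin.cases (fun hn' => ?_) (fun k hn' => ?_) k
  · have h1 := h0 n' hn'
    have h2 : (0 : Fin (ℓ + 1)) ≤ i.succ := Fin.zero_le _
    omega
  · simpa using h.2 k n' hn'

end Tail

namespace Problem

variable {F : Type u} [Field F] [MulSemiringAction (Multiplicative ℕ) F] {ℓ : ℕ}

/-- The entries of `v` are reduced modulo the `g_i`. -/
def Reduced (I : Problem F ℓ) (v : Fin (ℓ + 1) → SkewPolynomial F) : Prop :=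
  ∀ i n, (v i.succ).coeff n ≠ 0 → n < I.γ i.succ + natDeg (I.g i)

/-- A basis `W` of the row space in which the rows `1, …, ℓ` have the leading positions `1, …, ℓ`
and the degrees `T`, and the entries `1, …, ℓ` of row `0` consist of monomials below `b`. When the
rows `(0, …, g_i, …, 0)` are combined from `W`, the multiples of row `0` that are needed are small:
multiplying monomials below `e` by their coefficients stays below the leading monomial. -/
structure DDRows (I : Problem F ℓ) (b e : ℤ)
    (W : Fin (ℓ + 1) → Fin (ℓ + 1) → SkewPolynomial F) (T : Fin ℓ → ℕ) : Prop where
  basis : I.IsRowBasis W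
  lead : ∀ j : Fin ℓ, HasLead (tail (W j.succ)) (T j) j
  col : ∀ (j : Fin ℓ) n, (W j.succ 0).coeff n ≠ 0 → n ≤ T j
  top_le : ∀ j, T j ≤ I.μ
  below : Below b (tail (W 0))
  expand : ∀ i : Fin ℓ, ∃ a : Fin (ℓ + 1) → SkewPolynomial F,
    ∑ j, a j • W j = I.shiftedM i.succ ∧
      (a 0 ≠ 0 → ℓ * natDeg (a 0) + e < key (I.γ i.succ + natDeg (I.g i)) i)

variable {I : Problem F ℓ} {b e : ℤ} {W : Fin (ℓ + 1) → Fin (ℓ + 1) → SkewPolynomial F}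
  {T : Fin ℓ → ℕ}

theorem ddRows_shiftedM (hg : ∀ i, I.g i ≠ 0) (hb : Below b (tail (I.shiftedM 0))) (e : ℤ) :
    I.DDRows b e I.shiftedM (fun i => I.γ i.succ + natDeg (I.g i)) where
  basis := I.isRowBasis_shiftedM hg
  lead j := (I.hasLead_shiftedM_succ hg j).tail
  col j n hn := by
    rw [shiftedM_succ_zero] at hn
    exact absurd rfl hn
  top_le j := I.le_μ j
  below := hb
  expand i := by
    refine ⟨Pi.single i.succ 1, ?_, fun h => absurd (Pi.single_eq_of_ne ?_ _) h⟩
    · rw [Finset.sum_eq_single_of_mem i.succ (Finset.mem_univ _)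
        (fun k _ hk => by rw [Pi.single_eq_of_ne hk, zero_smul]), Pi.single_eq_same, one_smul]
    · exact (Fin.succ_ne_zero i).symm

/-- Changing row `0` by a combination of the other rows. -/
theorem DDRows.update_zero (hW : I.DDRows b e W T) {c : Fin (ℓ + 1) → SkewPolynomial F}
    (hc : c 0 = 0) {b' : ℤ} (hb : Below b' (tail (W 0 + ∑ i, c i • W i))) :
    I.DDRows b' e (Function.update W 0 (W 0 + ∑ i, c i • W i)) T where
  basis := hW.basis.update hc
  lead j := by
    rw [Function.update_of_ne (Fin.succ_ne_zero j)]
    exact hW.lead j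
  col j := by
    rw [Function.update_of_ne (Fin.succ_ne_zero j)]
    exact hW.col j
  top_le := hW.top_le
  below := by rwa [Function.update_self]
  expand i := by
    obtain ⟨a, ha, ha0⟩ := hW.expand i
    have h0 : a 0 - a 0 * c 0 = a 0 := by rw [hc, mul_zero, sub_zero]
    -- The old row `0` is the new one minus `∑ c i • W i`. As `c 0 = 0`, the multiple of row `0` is
    -- unchanged.
    refine ⟨fun j => a j - a 0 * c j, ?_, ?_⟩
    · rw [sum_smul_update_add]
      simp only [h0, sub_add_cancel]
      exact ha
    · simp only [h0]
      exact ha0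

/-- Cancelling the leading monomial of row `0` by row `h`. -/
theorem DDRows.cancel {N : ℕ} {h : Fin ℓ} (hW : I.DDRows (key N h + 1) e W T) (hN : T h ≤ N) :
    I.DDRows (key N h) e (Function.update W 0 (W 0 - monomial (N - T h)
      ((W 0 h.succ).coeff N / φ^[N - T h] ((W h.succ h.succ).coeff (T h))) • W h.succ)) T := by
  have hb := below_sub_monomial_smul hW.below (hW.lead h) hN
  simp only [tail_apply] at hb
  set α := monomial (N - T h)
    ((W 0 h.succ).coeff N / φ^[N - T h] ((W h.succ h.succ).coeff (T h)))
  have hsum : W 0 - α • W h.succ =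
      W 0 + ∑ i, (Pi.single h.succ (-α) : Fin (ℓ + 1) → SkewPolynomial F) i • W i := by
    rw [Finset.sum_eq_single_of_mem h.succ (Finset.mem_univ _)
      (fun k _ hk => by rw [Pi.single_eq_of_ne hk, zero_smul]), Pi.single_eq_same, neg_smul,
      ← sub_eq_add_neg]
  rw [hsum]
  refine hW.update_zero (Pi.single_eq_of_ne (Fin.succ_ne_zero h).symm _) ?_
  rw [← hsum, map_sub, map_smul]
  exact hb

/-- Swapping row `0` with row `h`, when row `0` has the smaller degree. -/
theorem DDRows.swap (hg : ∀ i, I.g i ≠ 0) {n : ℕ} {h : Fin ℓ}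
    (hW : I.DDRows (key n h + 1) (key n h) W T) (hn : (W 0 h.succ).coeff n ≠ 0)
    (h0 : ∀ k, (W 0 0).coeff k ≠ 0 → k ≤ n) (hnμ : n ≤ I.μ) :
    I.DDRows (key (T h) h + 1) (key (T h) h - 1) (W ∘ Equiv.swap 0 h.succ)
      (Function.update T h n) := by
  have hsw : ∀ j : Fin ℓ, j ≠ h → (Equiv.swap 0 h.succ) j.succ = j.succ := fun j hj =>
    Equiv.swap_apply_of_ne_of_ne (Fin.succ_ne_zero j) fun h' => hj (Fin.succ_injective _ h')
  refine ⟨hW.basis.comp_equiv _, fun j => ?_, fun j => ?_, fun j => ?_, ?_, fun i => ?_⟩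
  · by_cases hj : j = h
    · subst hj
      rw [Function.comp_apply, Equiv.swap_apply_right, Function.update_self]
      exact ⟨hn, hW.below⟩
    · rw [Function.comp_apply, hsw j hj, Function.update_of_ne hj]
      exact hW.lead j
  · by_cases hj : j = h
    · subst hj
      rw [Function.comp_apply, Equiv.swap_apply_right, Function.update_self]
      exact h0
    · rw [Function.comp_apply, hsw j hj, Function.update_of_ne hj]
      exact hW.col j
  · by_cases hj : j = h
    · subst hj
      rwa [Function.update_self]
    · rw [Function.update_of_ne hj]
      exact hW.top_le j
  · rw [Function.comp_apply, Equiv.swap_apply_left]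
    exact (hW.lead h).2
  · obtain ⟨a, ha, ha0⟩ := hW.expand i
    refine ⟨a ∘ Equiv.swap 0 h.succ, ?_, fun hne => ?_⟩
    · rw [← ha]
      exact Equiv.sum_comp (Equiv.swap 0 h.succ) fun j => a j • W j
    · rw [Function.comp_apply, Equiv.swap_apply_left] at hne ⊢
      -- The old bound on `a 0` makes `a 0 • W 0` small, so the part of the expansion over the rows
      -- `1, …, ℓ` does not exceed the leading monomial of row `i.succ` of `Φ_γ(M)`.
      have hb : Below (key (I.γ i.succ + natDeg (I.g i)) i + 1)
          (∑ j : Fin ℓ, a j.succ • tail (W j.succ)) := by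
        have hsum : ∑ j : Fin ℓ, a j.succ • tail (W j.succ) =
            tail (I.shiftedM i.succ) - a 0 • tail (W 0) := by
          rw [← ha, Fin.sum_univ_succ, map_add, map_smul, add_sub_cancel_left, map_sum]
          simp only [map_smul]
        rw [hsum]
        refine (I.hasLead_shiftedM_succ hg i).tail.2.sub ?_
        by_cases h00 : a 0 = 0
        · rw [h00, zero_smul]
          exact Below.zero _
        · refine (hW.below.smul le_rfl).mono ?_
          have := ha0 h00
          omega
      -- The coefficient of the old row `h` becomes that of row `0`. The predictable degree property
      -- bounds it up to equality, which is why the new bound is `key (T h) h - 1`.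
      have hlt := key_lt_of_below_sum_smul Function.injective_id hW.lead hb hne
      simp only [id] at hlt
      rw [key_add] at hlt
      omega

/-- Row `0` can be reduced modulo the `g_i`. -/
theorem DDRows.exists_reduced (hg : ∀ i, I.g i = X ^ natDeg (I.g i) + C ((I.g i).coeff 0))
    (ht : ∀ i, 0 < natDeg (I.g i)) (hbe : b ≤ e + 1) (hW : I.DDRows b e W T) :
    ∃ W', I.DDRows b e W' T ∧ W' 0 0 = W 0 0 ∧ (∀ j : Fin ℓ, W' j.succ = W j.succ) ∧
      I.Reduced (W' 0) := by
  obtain ⟨u, hu, huW⟩ := I.mem_rowSpace.1 (hW.basis.mem 0)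
  have hr : ∀ i, ∃ r q : SkewPolynomial F, u i.succ = r + q * I.g i ∧
      ∀ n, r.coeff n ≠ 0 → n < natDeg (I.g i) := by
    intro i
    obtain ⟨r, ⟨d, hd⟩, hr, -⟩ :=
      exists_modCoeff_eq_coeff (ht i) ((I.g i).coeff 0) (u 0) (I.s i)
    obtain ⟨d', hd'⟩ := hu i
    rw [← hg] at hd
    refine ⟨r, d - d', ?_, hr⟩
    rw [sub_mul, ← add_sub_assoc, ← hd, hd', add_sub_cancel_right]
  choose r q hq hr using hr
  choose a ha ha0 using hW.expand
  have hg0 : ∀ i, I.g i ≠ 0 := fun i h => by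
    have := ht i
    rw [h, natDeg_zero] at this
    omega
  -- A non-zero quotient means that row `0` contains the leading monomial of `q i * g i`, shifted by
  -- `γ`, which must lie below `b`.
  have hqlt : ∀ i, q i ≠ 0 → key (natDeg (q i) + (I.γ i.succ + natDeg (I.g i))) i < b := by
    intro i hi
    refine hW.below i _ ?_
    rw [tail_apply, ← huW, shift, coeff_mul_X_pow, if_pos (by omega)]
    have hne := leadCoeff_ne_zero (mul_ne_zero hi (hg0 i))
    rw [leadCoeff, natDeg_mul hi (hg0 i)] at hne
    have hidx : natDeg (q i) + (I.γ i.succ + natDeg (I.g i)) - I.γ i.succ =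
        natDeg (q i) + natDeg (I.g i) := by omega
    rw [hidx, hq, coeff_add]
    have h0 : (r i).coeff (natDeg (q i) + natDeg (I.g i)) = 0 := by
      by_contra h
      have := hr i _ h
      omega
    rwa [h0, zero_add]
  -- If both factors were non-zero, the number of the leading monomial of the shifted `g_i` would be
  -- less than `b ≤ e + 1` and greater than `e`. So subtracting `q i` times this row uses only the
  -- rows `1, …, ℓ` of `W`.
  have hqa : ∀ i, q i * a i 0 = 0 := by
    intro i
    by_contra h
    have h1 := hqlt i (left_ne_zero_of_mul h)
    have h2 := ha0 i (right_ne_zero_of_mul h)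
    rw [key_add] at h1
    have h3 : (0 : ℤ) ≤ ℓ * natDeg (q i) := by positivity
    have h4 : (0 : ℤ) ≤ ℓ * natDeg (a i 0) := by positivity
    omega
  have hsum : ∑ j, (-∑ i, q i * a i j) • W j = -∑ i, q i • I.shiftedM i.succ := by
    simp only [← ha, neg_smul, Finset.sum_neg_distrib, Finset.sum_smul, Finset.smul_sum, mul_smul]
    rw [Finset.sum_comm]
  have hrow : W 0 + ∑ j, (-∑ i, q i * a i j) • W j =
      Fin.cons (W 0 0) fun i => r i * X ^ I.γ i.succ := by
    rw [hsum]
    funext k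
    refine Fin.cases ?_ (fun i => ?_) k
    · simp [Finset.sum_apply, shiftedM_succ_zero]
    · rw [Fin.cons_succ, Pi.add_apply, Pi.neg_apply, Finset.sum_apply, ← huW,
        Finset.sum_eq_single_of_mem i (Finset.mem_univ i)]
      · rw [Pi.smul_apply, smul_eq_mul, shiftedM_succ_succ, Pi.single_eq_same, shift, hq, add_mul,
          mul_assoc, add_neg_cancel_right]
      · intro k _ hk
        rw [Pi.smul_apply, smul_eq_mul, shiftedM_succ_succ, Pi.single_eq_of_ne hk.symm, zero_mul,
          mul_zero]
  refine ⟨_, hW.update_zero (c := fun j => -∑ i, q i * a i j) (b' := b) ?_ ?_, ?_, fun j => ?_, ?_⟩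
  · simp [hqa]
  · rw [hsum, ← sub_eq_add_neg, map_sub, map_sum]
    refine hW.below.sub (Below.sum _ fun i _ => ?_)
    by_cases hi : q i = 0
    · rw [hi, zero_smul, map_zero]
      exact Below.zero _
    · rw [map_smul]
      refine ((I.hasLead_shiftedM_succ hg0 i).tail.smul hi).2.mono ?_
      have := hqlt i hi
      omega
  · rw [Function.update_self, hrow, Fin.cons_zero]
  · rw [Function.update_of_ne (Fin.succ_ne_zero j)]
  · rw [Function.update_self, hrow]
    intro i n hn
    rw [Fin.cons_succ, coeff_mul_X_pow] at hn
    split_ifs at hn with h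
    · have := hr i _ hn
      omega
    · exact absurd rfl hn

end Problem

/-! ### The demand-driven algorithm -/

namespace DDState

variable {F : Type u} [Field F] {ℓ : ℕ} (S : DDState F ℓ)

@[simp] theorem decrement_lam : S.decrement.lam = S.lam := by
  unfold decrement
  split_ifs <;> rfl

@[simp] theorem decrement_lead : S.decrement.lead = S.lead := by
  unfold decrement
  split_ifs <;> rfl

@[simp] theorem decrement_top : S.decrement.top = S.top := by
  unfold decrement
  split_ifs <;> rfl

theorem decrement_η_le : S.decrement.η ≤ S.η := by
  unfold decrement
  split_ifs
  · exact Int.sub_le_self _ zero_le_one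
  · exact le_rfl

theorem decrement_level :
    (ℓ : ℤ) * S.decrement.η + (S.decrement.h : ℕ) = ℓ * S.η + (S.h : ℕ) - 1 := by
  have := S.h.isLt
  unfold decrement
  split_ifs with h
  · simp only
    rw [Nat.cast_sub (by omega), h, mul_sub]
    push_cast
    ring
  · simp only
    rw [Nat.cast_sub (by omega)]
    push_cast
    ring

end DDState

namespace Problem

variable {F : Type u} [Field F] [MulSemiringAction (Multiplicative ℕ) F] {ℓ : ℕ}

/-- The state `S` of the demand-driven algorithm represents the basis `W` of the row space, where
the rows `1, …, ℓ` have the degrees `T`. -/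
structure DDInvariant (I : Problem F ℓ) (S : DDState F ℓ)
    (W : Fin (ℓ + 1) → Fin (ℓ + 1) → SkewPolynomial F) (T : Fin ℓ → ℕ) : Prop where
  rows : I.DDRows (ℓ * S.η + (S.h : ℕ) + 1) (ℓ * S.η + (S.h : ℕ)) W T
  reduced : I.Reduced (W 0)
  lam_eq : ∀ j, W j 0 = S.lam j
  top_eq : ∀ j, S.top j = T j
  lead_eq : ∀ j : Fin ℓ, (W j.succ j.succ).coeff (T j) = S.lead j
  η_le : S.η ≤ I.μ
  lam_le : natDeg (S.lam 0) ≤ I.μ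

/-- All `g_i` are of the form `x^t + c` with `t > 0`. -/
def IsBinomial (I : Problem F ℓ) : Prop :=
  ∀ i, 0 < natDeg (I.g i) ∧ I.g i = X ^ natDeg (I.g i) + C ((I.g i).coeff 0)

variable {I : Problem F ℓ}

theorem isBinomial_of_forall
    (h : ∀ i, ∃ (t : ℕ) (a : F), 0 < t ∧ I.g i = X ^ t + C a) : I.IsBinomial := by
  intro i
  obtain ⟨t, a, ht, hg⟩ := h i
  have hc : ∀ n, (I.g i).coeff n = (if t = n then 1 else 0) + if n = 0 then a else 0 := by
    intro n
    rw [hg, coeff_add, ← monomial_one_right_eq_X_pow, coeff_monomial, coeff_C]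
  have hd : natDeg (I.g i) = t := by
    refine natDeg_eq ?_ fun n hn => ?_
    · rw [hc, if_pos rfl, if_neg (by omega), add_zero]
      exact one_ne_zero
    · by_contra h
      rw [hc, if_neg (by omega), if_neg (by omega), add_zero] at hn
      exact hn rfl
  refine ⟨hd ▸ ht, ?_⟩
  rw [hd, hc 0, if_neg (by omega), if_pos rfl, zero_add]
  exact hg

theorem remCoeff_val (hI : I.IsBinomial) {i : Fin ℓ} {a w : SkewPolynomial F}
    (h : ModEq (I.g i) (a * I.s i) w) (hw : ∀ n, w.coeff n ≠ 0 → n < natDeg (I.g i)) (n : ℕ) :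
    (I.remCoeff i a n).val = w.coeff n := by
  obtain ⟨r, hr, hlt, hval⟩ := exists_modCoeff_eq_coeff (hI i).1 ((I.g i).coeff 0) a (I.s i)
  rw [← (hI i).2] at hr
  rw [remCoeff, hval, hr.eq_of_lt h hlt hw]

theorem remCoeff_ops_le (hI : I.IsBinomial) (hs : ∀ i, deg (I.s i) ≤ deg (I.g i)) (i : Fin ℓ)
    {a : SkewPolynomial F} (ha : natDeg a ≤ I.μ) (n : ℕ) : (I.remCoeff i a n).ops ≤ 33 * I.μ :=
  modCoeff_ops (hI i).1 (by have := I.le_μ i; omega) _ ha (natDeg_le_of_deg_le (hs i)) n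

theorem Reduced.lt_of_shift {u : Fin (ℓ + 1) → SkewPolynomial F} (h : I.Reduced (shift I.γ u))
    (i : Fin ℓ) (n : ℕ) (hn : (u i.succ).coeff n ≠ 0) : n < natDeg (I.g i) := by
  have := h i (n + I.γ i.succ)
  rw [shift, coeff_mul_X_pow, if_pos (by omega), Nat.add_sub_cancel] at this
  have := this hn
  omega

/-- The algorithm inspects the coefficients of row `0`. -/
theorem DDInvariant.ddCoeff_val (hI : I.IsBinomial) {S : DDState F ℓ}
    {W : Fin (ℓ + 1) → Fin (ℓ + 1) → SkewPolynomial F} {T : Fin ℓ → ℕ}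
    (hS : I.DDInvariant S W T) {n : ℕ} (hn : S.η = n) :
    (I.ddCoeff S).val = (W 0 S.h.succ).coeff n := by
  obtain ⟨u, hu, huW⟩ := I.mem_rowSpace.1 (hS.rows.basis.mem 0)
  rw [ddCoeff]
  have h1 : W 0 S.h.succ = u S.h.succ * X ^ I.γ S.h.succ := (congrFun huW _).symm
  split_ifs with h
  · rw [h1, coeff_mul_X_pow, if_neg (by omega)]
    rfl
  · have h2 : S.lam 0 = u 0 * X ^ I.γ 0 := (hS.lam_eq 0).symm.trans (congrFun huW _).symm
    have hred : I.Reduced (shift I.γ u) := huW ▸ hS.reduced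
    have h3 : (S.η - I.γ S.h.succ).toNat = n - I.γ S.h.succ := by omega
    rw [h2, shiftDown_mul_X_pow, h3, remCoeff_val hI (hu _) (hred.lt_of_shift _), h1,
      coeff_mul_X_pow, if_pos (by omega)]

theorem natDeg_shiftDown_le {v : Fin (ℓ + 1) → SkewPolynomial F} (hv : v ∈ I.rowSpace) {D : ℕ}
    (hD : natDeg (v 0) ≤ D) : natDeg (shiftDown (I.γ 0) (v 0)) ≤ D := by
  obtain ⟨u, -, rfl⟩ := I.mem_rowSpace.1 hv
  simp only [shift, shiftDown_mul_X_pow] at hD ⊢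
  by_cases hu : u 0 = 0
  · simp [hu]
  · rw [natDeg_mul_X_pow hu] at hD
    omega

theorem DDInvariant.ddCoeff_ops_le (hI : I.IsBinomial) (hs : ∀ i, deg (I.s i) ≤ deg (I.g i))
    {S : DDState F ℓ} {W : Fin (ℓ + 1) → Fin (ℓ + 1) → SkewPolynomial F} {T : Fin ℓ → ℕ}
    (hS : I.DDInvariant S W T) : (I.ddCoeff S).ops ≤ 33 * I.μ := by
  rw [ddCoeff]
  split_ifs
  · simp
  · refine remCoeff_ops_le hI hs _ ?_ _
    have := hS.lam_le
    rw [← hS.lam_eq] at this ⊢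
    exact natDeg_shiftDown_le (hS.rows.basis.mem 0) this

/-- The potential of the demand-driven algorithm. -/
def ddPotential (S : DDState F ℓ) : ℤ := ℓ * (S.η + ∑ j, S.top j) + (S.h : ℕ)

theorem IsBinomial.g_ne_zero (hI : I.IsBinomial) (i : Fin ℓ) : I.g i ≠ 0 := fun h => by
  have := (hI i).1
  rw [h, natDeg_zero] at this
  omega

/-- A reduction step and the following decrement. -/
theorem exists_ddInvariant_reduce (hI : I.IsBinomial) {S : DDState F ℓ}
    {W : Fin (ℓ + 1) → Fin (ℓ + 1) → SkewPolynomial F} {T : Fin ℓ → ℕ} {N : ℕ} {α : F}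
    (hW : I.DDRows (key N S.h + 1) (key N S.h - 1) W T) (hlam : ∀ j, W j 0 = S.lam j)
    (htop : ∀ j, S.top j = T j) (hlead : ∀ j : Fin ℓ, (W j.succ j.succ).coeff (T j) = S.lead j)
    (hη : S.η = N) (hα : (W 0 S.h.succ).coeff N = α) (hN : T S.h ≤ N) (hNμ : N ≤ I.μ)
    (h0 : ∀ k, (W 0 0).coeff k ≠ 0 → k ≤ N) :
    (∃ W', I.DDInvariant (S.reduce α).val.decrement W' T) ∧
      ddPotential (S.reduce α).val.decrement = ddPotential S - 1 ∧
      (S.reduce α).ops ≤ 3 * I.μ + 5 := by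
  have hβ : (S.η - S.top S.h).toNat = N - T S.h := by
    rw [hη, htop]
    omega
  set S' := (S.reduce α).val with hS'
  have hval : S' = { S with
      lam := Function.update S.lam 0 (S.lam 0 - monomial (N - T S.h)
        (α / φ^[N - T S.h] (S.lead S.h)) * S.lam S.h.succ) } := by
    rw [hS', DDState.reduce]
    simp only [Cost.val_bind, Cost.val_pure, val_frob, val_div, subMulShift_val, hβ]
  have hlevel := S'.decrement_level
  have hlevel' : (ℓ : ℤ) * S.η + (S.h : ℕ) = key N S.h := by rw [hη, key]
  have hlam' : S'.lam = Function.update S.lam 0 (S.lam 0 - monomial (N - T S.h)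
      (α / φ^[N - T S.h] (S.lead S.h)) * S.lam S.h.succ) := by rw [hval]
  have hη' : S'.η = S.η := by rw [hval]
  have hh' : S'.h = S.h := by rw [hval]
  have htop' : S'.top = S.top := by rw [hval]
  rw [hη', hh', hlevel'] at hlevel
  refine ⟨?_, ?_, ?_⟩
  · have hc := hW.cancel hN
    rw [hα, hlead] at hc
    obtain ⟨W', hW', h00, hsucc, hred⟩ :=
      hc.exists_reduced (fun i => (hI i).2) (fun i => (hI i).1) (by omega)
    rw [Function.update_self] at h00
    have hW0 : W' 0 0 = S'.lam 0 := by
      rw [h00, hlam', Function.update_self, Pi.sub_apply, Pi.smul_apply, smul_eq_mul, hlam, hlam]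
    -- By `col` the entry `λ_h` has degree at most `T h`, so its multiple by `x^(N - T h)` stays
    -- within `N`.
    have hlamN : ∀ k, (S'.lam 0).coeff k ≠ 0 → k ≤ N := by
      intro k hk
      rw [← hW0, h00, Pi.sub_apply, Pi.smul_apply, smul_eq_mul, coeff_sub, coeff_monomial_mul] at hk
      by_cases h1 : (W 0 0).coeff k = 0
      · rw [h1, zero_sub, neg_ne_zero] at hk
        split_ifs at hk with h2
        · have h3 := hW.col S.h (k - (N - T S.h)) fun h4 => right_ne_zero_of_mul hk
            ((phi_iterate_eq_zero _).2 h4)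
          omega
        · exact absurd rfl hk
      · exact h0 k h1
    refine ⟨W', ⟨?_, hred, ?_, ?_, ?_, ?_, ?_⟩⟩
    · rw [hlevel]
      convert hW' using 1
      ring
    · intro j
      rw [DDState.decrement_lam]
      refine Fin.cases hW0 (fun i => ?_) j
      rw [hsucc, Function.update_of_ne (Fin.succ_ne_zero i), hlam, hlam',
        Function.update_of_ne (Fin.succ_ne_zero i)]
    · intro j
      rw [DDState.decrement_top, htop', htop]
    · intro j
      rw [DDState.decrement_lead, hsucc, Function.update_of_ne (Fin.succ_ne_zero j), hlead, hval]
    · have := S'.decrement_η_le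
      omega
    · rw [DDState.decrement_lam]
      exact (natDeg_le hlamN).trans hNμ
  · rw [ddPotential, ddPotential, DDState.decrement_top, htop', mul_add, mul_add]
    linarith
  · rw [DDState.reduce]
    simp only [Cost.ops_bind, Cost.ops_pure, ops_frob, ops_div]
    have h1 := fun q β => subMulShift_ops q β (S.lam 0) (S.lam S.h.succ)
    have h2 : natDeg (S.lam S.h.succ) ≤ I.μ := by
      rw [← hlam]
      exact natDeg_le fun n hn => (hW.col _ n hn).trans (hW.top_le _)
    have h3 := h1 ((div α ((frob (S.η - S.top S.h).toNat (S.lead S.h)).val)).val)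
      (S.η - S.top S.h).toNat
    omega

/-- A zero coefficient means that row `0` has no monomial at the current level, so only the level
moves. Otherwise a cancellation, after a swap if row `0` has the smaller degree, clears the level. A
swap only exchanges `η` with `top h`, so the potential changes through the decrement alone. The cost
is `33 μ` for the coefficient and `3 μ + 5 ≤ 8 μ` for the reduction. -/
theorem DDInvariant.step (hI : I.IsBinomial) (hs : ∀ i, deg (I.s i) ≤ deg (I.g i))
    {S : DDState F ℓ} {c : Cost (DDState F ℓ)} (hc : I.DDStep S c)
    {W : Fin (ℓ + 1) → Fin (ℓ + 1) → SkewPolynomial F} {T : Fin ℓ → ℕ}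
    (hS : I.DDInvariant S W T) :
    (∃ W' T', I.DDInvariant c.val W' T') ∧ ddPotential c.val = ddPotential S - 1 ∧
      c.ops ≤ 41 * I.μ := by
  obtain ⟨hrun, rfl⟩ := hc
  have hops := hS.ddCoeff_ops_le hI hs
  have hμ : 1 ≤ I.μ := by
    have h1 := I.le_μ S.h
    have h2 := (hI S.h).1
    omega
  by_cases hα : (I.ddCoeff S).val = 0
  · have hval : (I.ddBody S).val = S.decrement := by
      simp only [ddBody, Cost.val_bind, if_pos hα, Cost.val_pure]
    have hopsB : (I.ddBody S).ops = (I.ddCoeff S).ops := by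
      simp only [ddBody, Cost.ops_bind, if_pos hα, Cost.ops_pure, add_zero]
    rw [hval, hopsB]
    have hlevel := S.decrement_level
    refine ⟨⟨W, T, ⟨?_, hS.reduced, ?_, ?_, ?_, S.decrement_η_le.trans hS.η_le, ?_⟩⟩, ?_, by omega⟩
    · refine { hS.rows with below := ?_, expand := ?_ }
      · intro k n hn
        have h1 := hS.rows.below k n hn
        refine lt_of_le_of_ne (by omega) fun heq => ?_
        have h2 : key n k = ℓ * S.η + (S.h : ℕ) := by omega
        -- `η` is an integer and may be negative, but a monomial at the current level has a
        -- non-negative number, while `h < ℓ`.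
        have h3 : 0 ≤ S.η := by
          by_contra hneg
          have h4 : (ℓ : ℤ) * S.η ≤ ℓ * (-1) := by gcongr; omega
          have h5 := S.h.isLt
          have h6 : 0 ≤ key n k := by unfold key; positivity
          omega
        obtain ⟨N, hN⟩ := Int.eq_ofNat_of_zero_le h3
        rw [hN] at h2
        obtain ⟨rfl, rfl⟩ := key_inj.1 (h2 : key n k = key N S.h)
        rw [hS.ddCoeff_val hI hN] at hα
        exact hn hα
      · intro i
        obtain ⟨a, ha, ha0⟩ := hS.rows.expand i
        refine ⟨a, ha, fun h => ?_⟩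
        have := ha0 h
        omega
    · simpa using hS.lam_eq
    · simpa using hS.top_eq
    · simpa using hS.lead_eq
    · simpa using hS.lam_le
    · rw [ddPotential, ddPotential, DDState.decrement_top, mul_add, mul_add]
      linarith
  · set α := (I.ddCoeff S).val with hαdef
    have hη0 : 0 ≤ S.η := by
      by_contra hneg
      apply hα
      rw [hαdef, ddCoeff, if_pos (by omega)]
      rfl
    obtain ⟨n, hn⟩ := Int.eq_ofNat_of_zero_le hη0
    have hαn : (W 0 S.h.succ).coeff n = α := (hS.ddCoeff_val hI hn).symm
    have hrows : I.DDRows (key n S.h + 1) (key n S.h) W T := by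
      have := hS.rows
      rw [hn] at this
      exact this
    have h0 : ∀ k, (W 0 0).coeff k ≠ 0 → k ≤ n := by
      intro k hk
      have := hrun k (mem_support_iff.2 (by rwa [← hS.lam_eq]))
      omega
    have hnμ : n ≤ I.μ := by
      have := hS.η_le
      omega
    by_cases hlt : S.η < S.top S.h
    · have hTn : n < T S.h := by
        have := hS.top_eq S.h
        omega
      have hbody : (I.ddBody S).val = ((S.swap α).2.reduce (S.lead S.h)).val.decrement := by
        simp only [ddBody, Cost.val_bind, ← hαdef, if_neg hα, if_pos hlt, Cost.val_pure]
        rfl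
      have hbops : (I.ddBody S).ops =
          (I.ddCoeff S).ops + ((S.swap α).2.reduce (S.lead S.h)).ops := by
        simp only [ddBody, Cost.ops_bind, ← hαdef, if_neg hα, if_pos hlt, Cost.ops_pure, add_zero]
        rfl
      have hsw := hrows.swap hI.g_ne_zero (hαn ▸ hα) h0 hnμ
      have hne : ∀ j : Fin ℓ, j ≠ S.h → (Equiv.swap 0 S.h.succ) j.succ = j.succ := fun j hj =>
        Equiv.swap_apply_of_ne_of_ne (Fin.succ_ne_zero j)
          fun h' => hj (Fin.succ_injective _ h')
      have hred := exists_ddInvariant_reduce (S := (S.swap α).2) hI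
        (N := T S.h) (α := S.lead S.h) hsw ?_ ?_ ?_ (hS.top_eq S.h) ?_ ?_ (hrows.top_le _) ?_
      · obtain ⟨⟨W', hW'⟩, hpot, ho⟩ := hred
        rw [hbody, hbops]
        refine ⟨⟨W', _, hW'⟩, ?_, by omega⟩
        rw [hpot]
        simp only [ddPotential, DDState.swap]
        have : ∑ j, Function.update S.top S.h S.η j = ∑ j, S.top j + S.η - S.top S.h := by
          rw [Finset.sum_update_of_mem (Finset.mem_univ _), Finset.sum_eq_add_sum_sdiff_singleton_of_mem
            (Finset.mem_univ S.h) S.top]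
          ring
        rw [this]
        ring
      · intro j
        simp only [DDState.swap, Function.comp_apply]
        refine Fin.cases ?_ (fun i => ?_) j
        · rw [Equiv.swap_apply_left, hS.lam_eq,
            Function.update_of_ne (Fin.succ_ne_zero _).symm, Function.update_self]
        · by_cases hi : i = S.h
          · rw [hi, Equiv.swap_apply_right, hS.lam_eq, Function.update_self]
          · rw [hne i hi, hS.lam_eq,
              Function.update_of_ne (fun h => hi (Fin.succ_injective _ h)),
              Function.update_of_ne (Fin.succ_ne_zero i)]
      · intro j
        simp only [DDState.swap]
        by_cases hj : j = S.h
        · rw [hj, Function.update_self, Function.update_self, hn]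
        · rw [Function.update_of_ne hj, Function.update_of_ne hj, hS.top_eq]
      · intro j
        simp only [DDState.swap, Function.comp_apply]
        by_cases hj : j = S.h
        · rw [hj, Equiv.swap_apply_right, Function.update_self, Function.update_self, hαn]
        · rw [hne j hj, Function.update_of_ne hj, Function.update_of_ne hj, hS.lead_eq]
      · simp only [DDState.swap, Function.comp_apply, Equiv.swap_apply_left]
        exact hS.lead_eq S.h
      · simp only [DDState.swap, Function.update_self]
        exact hTn.le
      · intro k hk
        rw [Function.comp_apply, Equiv.swap_apply_left] at hk
        exact hrows.col _ k hk
    · have hTn : T S.h ≤ n := by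
        have := hS.top_eq S.h
        omega
      have hbody : (I.ddBody S).val = (S.reduce α).val.decrement := by
        simp only [ddBody, Cost.val_bind, ← hαdef, if_neg hα, if_neg hlt, Cost.val_pure]
      have hbops : (I.ddBody S).ops = (I.ddCoeff S).ops + (S.reduce α).ops := by
        simp only [ddBody, Cost.ops_bind, ← hαdef, if_neg hα, if_neg hlt, Cost.ops_pure, add_zero]
      -- Without a swap the bound `e` is only weakened by one, to match the level after the
      -- decrement.
      have hrows' : I.DDRows (key n S.h + 1) (key n S.h - 1) W T :=
        { hrows with
          expand := fun i => by
            obtain ⟨a, ha, ha0⟩ := hrows.expand i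
            refine ⟨a, ha, fun h => ?_⟩
            have := ha0 h
            omega }
      obtain ⟨⟨W', hW'⟩, hpot, ho⟩ := exists_ddInvariant_reduce hI hrows' hS.lam_eq hS.top_eq
        hS.lead_eq hn hαn hTn hnμ h0
      rw [hbody, hbops]
      exact ⟨⟨W', T, hW'⟩, hpot, by omega⟩

end Problem

/-! ### Demand-driven algorithm: number of iterations, final basis, completion of the row -/

namespace Problem

variable {F : Type u} [Field F] [MulSemiringAction (Multiplicative ℕ) F] {ℓ : ℕ} {I : Problem F ℓ}

theorem DDInvariant.le_η {S : DDState F ℓ} {W : Fin (ℓ + 1) → Fin (ℓ + 1) → SkewPolynomial F}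
    {T : Fin ℓ → ℕ} (hS : I.DDInvariant S W T) {i : Fin ℓ} {n : ℕ}
    (hn : (W 0 i.succ).coeff n ≠ 0) : (n : ℤ) ≤ S.η := by
  have h1 := hS.rows.below i n hn
  have h2 := S.h.isLt
  by_contra h
  have h3 : (ℓ : ℤ) * (S.η + 1) ≤ ℓ * n := by gcongr; omega
  rw [mul_add, mul_one] at h3
  unfold key at h1
  omega

/-- While the loop runs, `η` bounds all degrees in row `0` and `top j` those in row `j.succ`, so
`IsRowBasis.sum_le` bounds `η + ∑ top` from below. -/
theorem DDInvariant.le_ddPotential [Finite F] {S : DDState F ℓ}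
    {W : Fin (ℓ + 1) → Fin (ℓ + 1) → SkewPolynomial F} {T : Fin ℓ → ℕ}
    (hS : I.DDInvariant S W T) (hrun : ∀ n ∈ (S.lam 0).support, (n : ℤ) ≤ S.η) :
    (ℓ : ℤ) * (I.γ 0 + ∑ i : Fin ℓ, ((I.γ i.succ + natDeg (I.g i) : ℕ) : ℤ)) ≤
      ddPotential S := by
  have h0 : ∀ k n, (W 0 k).coeff n ≠ 0 → (n : ℤ) ≤ S.η := by
    intro k n
    refine Fin.cases (fun hn => ?_) (fun i hn => hS.le_η hn) k
    rw [hS.lam_eq] at hn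
    exact hrun n (mem_support_iff.2 hn)
  obtain ⟨n, k, hl⟩ := exists_hasLead (hS.rows.basis.1.ne_zero 0)
  have hη : 0 ≤ S.η := (Int.natCast_nonneg n).trans (h0 k n hl.1)
  obtain ⟨N, hN⟩ := Int.eq_ofNat_of_zero_le hη
  have hsum := hS.rows.basis.sum_le (d := Fin.cons N T) fun j => by
    refine Fin.cases (fun k n hn => ?_) (fun j k n => ?_) j
    · have := h0 k n hn
      rw [Fin.cons_zero]
      omega
    · rw [Fin.cons_succ]
      exact Fin.cases (fun hn => hS.rows.col j n hn)
        (fun i hn => (hS.rows.lead j).le (k' := i) hn) k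
  rw [Fin.sum_univ_succ, Fin.sum_univ_succ, add_assoc, ← Finset.sum_add_distrib] at hsum
  simp only [Fin.cons_zero, Fin.cons_succ] at hsum
  have hsum' : (I.γ 0 : ℤ) + ∑ i : Fin ℓ, ((I.γ i.succ + natDeg (I.g i) : ℕ) : ℤ) ≤
      S.η + ∑ j, S.top j := by
    simp only [hN, hS.top_eq]
    exact_mod_cast hsum
  have := mul_le_mul_of_nonneg_left hsum' (Int.natCast_nonneg ℓ)
  rw [ddPotential]
  omega

/-- A bound for the number of iterations that remain. -/
def ddRemaining (I : Problem F ℓ) (S : DDState F ℓ) : ℕ :=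
  (ddPotential S + 1 -
    ℓ * (I.γ 0 + ∑ i : Fin ℓ, ((I.γ i.succ + natDeg (I.g i) : ℕ) : ℤ))).toNat

/-- The lower bound for the potential holds before the step, and the `+ 1` in `ddRemaining` makes
its argument positive there; the truncation thus cannot hide the drop. -/
theorem ddStep_remaining_lt [Finite F] (hI : I.IsBinomial)
    (hs : ∀ i, deg (I.s i) ≤ deg (I.g i)) {S : DDState F ℓ} {c : Cost (DDState F ℓ)}
    (hS : ∃ W T, I.DDInvariant S W T) (hc : I.DDStep S c) :
    (∃ W T, I.DDInvariant c.val W T) ∧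
      I.ddRemaining c.val < I.ddRemaining S ∧
      c.ops ≤ 41 * I.μ := by
  obtain ⟨W, T, hS⟩ := hS
  obtain ⟨h1, h2, h3⟩ := hS.step hI hs hc
  have h4 := hS.le_ddPotential hc.1
  exact ⟨h1, by unfold ddRemaining; omega, h3⟩

theorem hasLead_shiftedM_zero {h : Fin ℓ} (hh : leadPos (I.shiftedM 0) = h.succ) :
    HasLead (I.shiftedM 0) (natDeg (I.shiftedM 0 h.succ)) h.succ := by
  obtain ⟨n, hn⟩ := leadPos_eq_iff.1 hh
  rwa [hn.natDeg_eq]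

/-- Row `0` of `Φ_γ(M)` need not be reduced, as `deg s_i = deg g_i` is allowed, so it is reduced
first. This leaves column `0` alone, and any `e` is admissible because the expansions do not yet use
row `0`. -/
theorem exists_ddInvariant_ddInit (hI : I.IsBinomial) (hs : ∀ i, deg (I.s i) ≤ deg (I.g i))
    {h : Fin ℓ} (hh : leadPos (I.shiftedM 0) = h.succ) :
    ∃ W T, I.DDInvariant (I.ddInit h) W T := by
  have hl := hasLead_shiftedM_zero hh
  set n := natDeg (I.shiftedM 0 h.succ) with hn
  have hnμ : n ≤ I.μ := (I.le_of_coeff_shiftedM_succ hs hl.1).trans (I.le_μ h)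
  have hrows := ddRows_shiftedM hI.g_ne_zero hl.tail.2 (key n h)
  obtain ⟨W, hW, h00, hsucc, hred⟩ :=
    hrows.exists_reduced (fun i => (hI i).2) (fun i => (hI i).1) le_rfl
  refine ⟨W, _, ⟨hW, hred, fun j => ?_, fun j => rfl, fun j => ?_, ?_, ?_⟩⟩
  · refine Fin.cases ?_ (fun i => ?_) j
    · rw [h00, shiftedM_zero_zero]
      simp [ddInit]
    · rw [hsucc, shiftedM_succ_zero]
      simp [ddInit]
  · rw [hsucc, shiftedM_succ_succ, Pi.single_eq_same, coeff_mul_X_pow, if_pos (by omega),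
      Nat.add_sub_cancel_left]
    rfl
  · exact Int.ofNat_le.2 hnμ
  · refine natDeg_le fun k hk => ?_
    have h1 : (I.shiftedM 0 0).coeff k ≠ 0 := by
      rw [shiftedM_zero_zero]
      simpa [ddInit] using hk
    exact (hl.le h1).trans hnμ

theorem exists_ddRun [Finite F] (hI : I.IsBinomial) (hs : ∀ i, deg (I.s i) ≤ deg (I.g i)) :
    ∃ c, I.DDRun c := by
  have hcol : ∃ d, I.DDColumn d := by
    obtain ⟨n, k, hl⟩ := exists_hasLead ((I.isRowBasis_shiftedM hI.g_ne_zero).1.ne_zero 0)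
    have hk := leadPos_eq_iff.2 ⟨n, hl⟩
    revert hk
    refine Fin.cases (fun hk => ⟨_, Or.inl ⟨hk, rfl⟩⟩) (fun h hk => ?_) k
    obtain ⟨d, hd⟩ := (terminates_of_potential (Inv := fun S => ∃ W T, I.DDInvariant S W T)
      (pot := I.ddRemaining) (fun S c hS hc => ⟨(ddStep_remaining_lt hI hs hS hc).1,
        (ddStep_remaining_lt hI hs hS hc).2.1⟩)
      (exists_ddInvariant_ddInit hI hs hk)).exists_loop
    exact ⟨_, Or.inr ⟨h, hk, d, hd, rfl⟩⟩
  obtain ⟨d, hd⟩ := hcol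
  exact ⟨⟨(d.val, (I.completeRow (d.val 0)).val), d.ops + (I.completeRow (d.val 0)).ops⟩, d, hd,
    rfl, rfl⟩

theorem loop_dd_ops_le [Finite F] (hI : I.IsBinomial) (hs : ∀ i, deg (I.s i) ≤ deg (I.g i))
    {h : Fin ℓ} (hh : leadPos (I.shiftedM 0) = h.succ) {d : Cost (DDState F ℓ)}
    (hd : Loop I.DDStep (I.ddInit h) d) : d.ops ≤ 82 * (ℓ * I.μ ^ 2) := by
  have hops := hd.ops_le (Inv := fun S => ∃ W T, I.DDInvariant S W T)
    (pot := I.ddRemaining) (fun S c hS hc => ddStep_remaining_lt hI hs hS hc)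
    (exists_ddInvariant_ddInit hI hs hh)
  have hl := hasLead_shiftedM_zero hh
  have hnμ : natDeg (I.shiftedM 0 h.succ) ≤ I.μ :=
    (I.le_of_coeff_shiftedM_succ hs hl.1).trans (I.le_μ h)
  have hμ : 1 ≤ I.μ := by
    have h1 := I.le_μ h
    have h2 := (hI h).1
    omega
  -- Initially `∑ top` equals `∑ (γ_i + deg g_i)`, so only `ℓ (η - γ 0) + h + 1` remains, at most `ℓ
  -- μ + ℓ`.
  have hpot : I.ddRemaining (I.ddInit h) ≤ 2 * (ℓ * I.μ) := by
    rw [ddRemaining, Int.toNat_le]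
    simp only [ddPotential, ddInit, Nat.cast_add, mul_add]
    have h1 : (ℓ : ℤ) * natDeg (I.shiftedM 0 h.succ) ≤ ℓ * I.μ := by gcongr
    have h2 : (0 : ℤ) ≤ ℓ * I.γ 0 := by positivity
    have h3 : (ℓ : ℤ) * 1 ≤ ℓ * I.μ := by gcongr; exact_mod_cast hμ
    have h4 := h.isLt
    push_cast
    omega
  calc d.ops ≤ _ := (Nat.le_add_right _ _).trans hops
    _ ≤ 41 * I.μ * (2 * (ℓ * I.μ)) := Nat.mul_le_mul_left _ hpot
    _ = 82 * (ℓ * I.μ ^ 2) := by ring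

/-- The computed column belongs to a basis with the leading positions `0, …, ℓ`. -/
theorem DDColumn.exists_rows [Finite F] (hI : I.IsBinomial)
    (hs : ∀ i, deg (I.s i) ≤ deg (I.g i)) {c : Cost (Fin (ℓ + 1) → SkewPolynomial F)}
    (hc : I.DDColumn c) :
    (∃ (W : Fin (ℓ + 1) → Fin (ℓ + 1) → SkewPolynomial F) (T : Fin (ℓ + 1) → ℕ),
      I.IsRowBasis W ∧ I.Reduced (W 0) ∧ (∀ j, HasLead (W j) (T j) j) ∧
      ∀ j, shiftDown (I.γ 0) (W j 0) = c.val j) ∧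
    natDeg (c.val 0) ≤ I.μ ∧ c.ops ≤ 82 * (ℓ * I.μ ^ 2) := by
  rcases hc with ⟨hk, rfl⟩ | ⟨h, hh, d, hd, rfl⟩
  · obtain ⟨n, hl⟩ := leadPos_eq_iff.1 hk
    have hn : n = I.γ 0 := I.eq_of_coeff_shiftedM_zero hl.1
    have hlt : ∀ i n', (I.shiftedM 0 (Fin.succ i)).coeff n' ≠ 0 → n' < n := fun i n' hn' => by
      rcases (hasLead_iff.1 hl).2 _ _ hn' with h | h
      · exact h
      · exact absurd h.2 (by simp)
    -- Leading at position `0` means that all other entries have degree less than `n`; in the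
    -- numbering of `tail` the monomials of degree `n` start at `ℓ * n`.
    have hb : Below ((ℓ : ℤ) * n) (tail (I.shiftedM 0)) := fun i n' hn' => by
      have h1 : (ℓ : ℤ) * (n' + 1) ≤ ℓ * n := by
        have := hlt i n' hn'
        gcongr
        omega
      have h2 := i.isLt
      rw [mul_add, mul_one] at h1
      unfold key
      omega
    obtain ⟨W, hW, h00, hsucc, hred⟩ := (ddRows_shiftedM hI.g_ne_zero hb (ℓ * n)).exists_reduced
      (fun i => (hI i).2) (fun i => (hI i).1) (by omega)
    refine ⟨⟨W, Fin.cons n fun i => I.γ i.succ + natDeg (I.g i), hW.basis, hred, fun j => ?_,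
      fun j => ?_⟩, ?_, Nat.zero_le _⟩
    · refine Fin.cases ?_ (fun i => ?_) j
      · rw [hasLead_iff, Fin.cons_zero]
        refine ⟨h00 ▸ hl.1, fun k n' => Fin.cases (fun hn' => ?_) (fun i hn' => Or.inl ?_) k⟩
        · rw [h00] at hn'
          exact Or.inr ⟨(I.eq_of_coeff_shiftedM_zero hn').trans hn.symm, le_rfl⟩
        · have h1 := hW.below i n' hn'
          by_contra h2
          have h3 : (ℓ : ℤ) * n ≤ ℓ * n' := by gcongr; omega
          unfold key at h1
          omega
      · rw [Fin.cons_succ]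
        exact (hW.lead i).of_tail (hW.col i)
    · refine Fin.cases ?_ (fun i => ?_) j
      · rw [h00, shiftedM_zero_zero, ← one_mul (X ^ I.γ 0), shiftDown_mul_X_pow]
        simp
      · rw [hsucc, shiftedM_succ_zero, ← zero_mul (X ^ I.γ 0), shiftDown_mul_X_pow]
        simp
    · refine natDeg_le fun n hn => ?_
      simp only [Pi.single_eq_same, coeff_one] at hn
      by_contra h
      exact hn (if_neg (by omega))
  · obtain ⟨W, T, hS⟩ := hd.invariant
      (Inv := fun S => ∃ W T, I.DDInvariant S W T) (fun S c hS hc => (ddStep_remaining_lt hI hs hS hc).1)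
      (exists_ddInvariant_ddInit hI hs hh)
    refine ⟨⟨W, Fin.cons (natDeg (d.val.lam 0)) T, hS.rows.basis, hS.reduced, fun j => ?_,
      fun j => by rw [hS.lam_eq]⟩, ?_, loop_dd_ops_le hI hs hh hd⟩
    · refine Fin.cases ?_ (fun i => ?_) j
      · have hexit : ¬ ∀ n ∈ (d.val.lam 0).support, (n : ℤ) ≤ d.val.η :=
          fun h => hd.not_step _ ⟨h, rfl⟩
        push Not at hexit
        obtain ⟨n, hn, hlt⟩ := hexit
        have hn' := mem_support_iff.1 hn
        rw [hasLead_iff, Fin.cons_zero, hS.lam_eq]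
        refine ⟨leadCoeff_ne_zero fun h0 => hn' (by rw [h0]; rfl), fun k n' => ?_⟩
        refine Fin.cases (fun hk => ?_) (fun i hk => ?_) k
        · rw [hS.lam_eq] at hk
          have h1 := le_natDeg hk
          have h2 : (0 : Fin (ℓ + 1)) ≤ 0 := le_rfl
          omega
        · have h1 := hS.le_η hk
          have h2 := le_natDeg hn'
          omega
      · rw [Fin.cons_succ]
        exact (hS.rows.lead i).of_tail (hS.rows.col i)
    · have h1 := hS.lam_le
      simp only
      rw [← hS.lam_eq] at h1 ⊢
      exact natDeg_shiftDown_le (hS.rows.basis.mem 0) h1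

/-- Reduced entries are determined by `u 0` through the congruences, as remainders are unique. -/
theorem completeRow_val (hI : I.IsBinomial) {u : Fin (ℓ + 1) → SkewPolynomial F}
    (hu : ∀ i, ModEq (I.g i) (u 0 * I.s i) (u i.succ)) (hred : I.Reduced (shift I.γ u)) :
    (I.completeRow (u 0)).val = u := by
  have key : ∀ i N n, (Cost.forRange (fun n (p : SkewPolynomial F) => do
      let t ← I.remCoeff i (u 0) n
      pure (p.update n t)) N 0).val.coeff n = if n < N then (u i.succ).coeff n else 0 := by
    intro i N
    induction N with
    | zero => simp
    | succ N ih =>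
      intro n
      simp only [Cost.forRange_succ, Cost.val_bind, Cost.val_pure, coeff_update,
        Function.update_apply, ih, remCoeff_val hI (hu i) (hred.lt_of_shift i)]
      by_cases hn : n = N
      · subst hn
        simp
      · rw [if_neg hn]
        refine if_congr ?_ rfl rfl
        omega
  funext k
  refine Fin.cases rfl (fun i => ?_) k
  ext n
  refine (key i _ n).trans ?_
  split_ifs with h
  · rfl
  · by_contra hne
    exact h (hred.lt_of_shift i n (Ne.symm hne))

theorem completeRow_ops_le (hI : I.IsBinomial) (hs : ∀ i, deg (I.s i) ≤ deg (I.g i))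
    {a : SkewPolynomial F} (ha : natDeg a ≤ I.μ) :
    (I.completeRow a).ops ≤ 33 * (ℓ * I.μ ^ 2) := by
  simp only [completeRow, Cost.ops_bind, Cost.ops_pure, Cost.ops_pi, add_zero]
  calc _ ≤ ∑ _i : Fin ℓ, I.μ * (33 * I.μ) := by
        refine Finset.sum_le_sum fun i _ => ?_
        refine (Cost.ops_forRange_le (B := 33 * I.μ) (fun n p => ?_) _ _).trans ?_
        · simpa using remCoeff_ops_le hI hs i ha n
        · refine Nat.mul_le_mul_right _ ?_
          have := I.le_μ i
          omega
    _ = 33 * (ℓ * I.μ ^ 2) := by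
        simp only [Finset.sum_const, Finset.card_univ, Fintype.card_fin, smul_eq_mul]
        ring

theorem ddRun_correct [Finite F] (hℓ : 0 < ℓ) (hI : I.IsBinomial)
    (hs : ∀ i, deg (I.s i) ≤ deg (I.g i))
    {c : Cost ((Fin (ℓ + 1) → SkewPolynomial F) × (Fin (ℓ + 1) → SkewPolynomial F))}
    (hc : I.DDRun c) :
    (∃ V, I.IsReduction V ∧ (∀ j, V j 0 = c.val.1 j) ∧ V 0 = c.val.2 ∧
      leadPos (shift I.γ (V 0)) = (0 : Fin (ℓ + 1))) ∧
    I.IsSolution c.val.2 ∧ c.ops ≤ 115 * (ℓ * I.μ ^ 2) := by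
  obtain ⟨d, hd, hval, hops⟩ := hc
  obtain ⟨⟨W, T, hb, hred, hlead, hcol⟩, hdeg, hdops⟩ := hd.exists_rows hI hs
  have hV : ∀ j, shift I.γ (fun k => shiftDown (I.γ k) (W j k)) = W j :=
    fun j => I.shift_shiftDown (hb.mem j)
  have hrow : (fun k => shiftDown (I.γ k) (W 0 k)) = c.val.2 := by
    obtain ⟨u, hu, huW⟩ := I.mem_rowSpace.1 (hb.mem 0)
    have h1 : (fun k => shiftDown (I.γ k) (W 0 k)) = u := by
      rw [← huW]
      exact funext fun k => shiftDown_mul_X_pow _ _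
    rw [h1, hval, ← hcol 0, congrFun h1 0, completeRow_val hI hu (huW ▸ hred)]
  refine ⟨⟨fun j k => shiftDown (I.γ k) (W j k),
    hb.isReduction hV Function.injective_id hlead, fun j => ?_, hrow, ?_⟩, ?_, ?_⟩
  · rw [hval]
    exact hcol j
  · rw [hV]
    exact leadPos_eq_iff.2 ⟨_, hlead 0⟩
  · exact hb.isSolution hℓ Function.injective_id hlead (j := 0) rfl (hrow ▸ hV 0)
  · have := completeRow_ops_le hI hs hdeg
    omega

end Problem

end SkewShiftRegister

end

/-! ### Both realisations together -/

theorem mainTheorem1 :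
    ∃ K : ℕ, ∀ (F : Type*) [Field F] [Finite F] (θ : F ≃+* F),
      letI : MulSemiringAction (Multiplicative ℕ) F := SkewShiftRegister.autAction θ
      ∀ (ℓ : ℕ) (I : SkewShiftRegister.Problem F ℓ), 0 < ℓ → (∀ i, I.g i ≠ 0) →
        (∀ i, SkewShiftRegister.deg (I.s i) ≤ SkewShiftRegister.deg (I.g i)) →
        ((SkewShiftRegister.Terminates SkewShiftRegister.MSStep I.shiftedM ∧
          (∃ c, I.MSRun c) ∧
          ∀ c, I.MSRun c →
            I.IsReduction c.val.1 ∧ I.IsSolution c.val.2 ∧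
            (1 ≤ I.μ → c.ops ≤ K * (ℓ ^ 2 * I.μ ^ 2))) ∧
        ((∀ i, ∃ (t : ℕ) (a : F), 0 < t ∧
            I.g i = SkewPolynomial.X ^ t + SkewPolynomial.C a) →
          (∃ c, I.DDRun c) ∧
          ∀ c, I.DDRun c →
            (∃ V, I.IsReduction V ∧ (∀ j, V j 0 = c.val.1 j) ∧ V 0 = c.val.2 ∧
              SkewShiftRegister.leadPos (SkewShiftRegister.shift I.γ (V 0)) =
                (0 : Fin (ℓ + 1))) ∧
            I.IsSolution c.val.2 ∧ c.ops ≤ K * (ℓ * I.μ ^ 2))) := by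
  -- `82` for the demand-driven loop and `33` for completing the row; this also covers the `42` of
  -- the Mulders–Storjohann bound.
  refine ⟨115, ?_⟩
  intro F _ _ θ
  let : MulSemiringAction (Multiplicative ℕ) F := SkewShiftRegister.autAction θ
  intro ℓ I hℓ hg hs
  refine ⟨⟨SkewShiftRegister.Problem.terminates_ms hg hs,
    SkewShiftRegister.Problem.exists_msRun hg hs, fun c hc => ?_⟩, fun hbin => ?_⟩
  · obtain ⟨h1, h2⟩ := SkewShiftRegister.Problem.msRun_correct hℓ hg hs hc
    refine ⟨h1, h2, fun hμ => ?_⟩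
    exact (SkewShiftRegister.Problem.msRun_ops_le hℓ hg hs hμ hc).trans
      (Nat.mul_le_mul_right _ (by norm_num))
  · have hI := SkewShiftRegister.Problem.isBinomial_of_forall hbin
    exact ⟨SkewShiftRegister.Problem.exists_ddRun hI hs,
      fun c hc => SkewShiftRegister.Problem.ddRun_correct hℓ hI hs hc⟩
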